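/- Fix $n\ge 2$ players and parameters $x_0,\sigma\in(0,\infty)$, $\mu\in\mathbb{R}$. Each player $i$ privately observes $X^i$, the process $x_0+\mu t+\sigma W^i_t$ absorbed at $0$, where $W^1,\dots,W^n$ are independent standard Brownian motions, and chooses a possibly randomized, almost surely finite stopping time $\tau_i$. The players are ranked by their stopping levels $X^i_{\tau_i}$, ties being split uniformly at random, and the player of rank $k$ receives $R_k$. A reward scheme $R=(R_1,\dots,R_n)$ is normalized if $R_1\ge\dots\ge R_n=0$ and $\sum_{k=1}^n R_k=1$. For normalized schemes write $\tilde R\le_L R$ (Lorenz order) if $\sum_{i=1}^k\tilde R_i\le\sum_{i=1}^k R_i$ for $k=1,\dots,n$. Let $\mathcal F$ be the set of laws of $X_\tau$ over all such stopping times $\tau$. For $F\in\mathcal F$ let $u^F(x)$ be the expected reward of a player stopping at level $x$ when the other $n-1$ players stop independently at levels with law $F$. The law $F\in\mathcal F$ is an equilibrium for $R$ if $\int u^F\,dF\ge\int u^F\,d\tilde F$ for all $\tilde F\in\mathcal F$, and $\tau$ is an equilibrium stopping time for $R$ if the law of $X_\tau$ is an equilibrium for $R$. Let $\bar R=\frac1n\sum_k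 R_k$ and $$\bar\mu_R=\frac{\sigma^2}{2x_0}\log\Big(\frac{R_1-R_n}{R_1-\bar R}\Big).$$ It is assumed throughout that $\mu<\bar\mu_R$ for the schemes $R$ under consideration. Then the expected duration of play $E[\tau]$ in equilibrium is finite and monotone increasing with respect to the Lorenz order of the reward scheme: if $R,\tilde R$ are normalized schemes with $\mu<\bar\mu_R$, $\mu<\bar\mu_{\tilde R}$ and $\tilde R\le_L R$, and if $\tau,\tilde\tau$ are any equilibrium stopping times for $R$ and $\tilde R$, respectively, then $E[\tilde\tau]\le E[\tau]<\infty$. (In particular, $E[\tau]$ depends only on $R$ and not on the choice of the equilibrium stopping time.) In particular, $E[\tau]$ is maximized among all normalized schemes by the winner-takes-all scheme $(1,0,\dots,0)$ if $\mu<\bar\mu_{(1,0,\dots,0)}=\frac{\sigma^2}{2x_0}\log\frac{n}{n-1}$, and it is minimized among all normalized schemes $R$ with $\mu<\bar\mu_R$ by the uniform scheme $\big(\frac1{n-1},\dots,\frac1{n-1},0\big)$. -/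

import Mathlib

open MeasureTheory ProbabilityTheory
open scoped NNReal ENNReal

universe u v

namespace RankGame

noncomputable section

/-! ### Rewards

A reward vector `R₁, …, Rₙ` is a function `R : ℕ → ℝ` of which only the values at the ranks
`1, …, n` matter. -/

/-- A normalized reward scheme for `n` players: `R₁ ≥ … ≥ Rₙ = 0` and total reward `1`
(so all rewards are nonnegative, and `R₁ > Rₙ`). -/
structure IsNormalizedScheme (n : ℕ) (R : ℕ → ℝ) : Prop where
  antitone : AntitoneOn R (Set.Icc 1 n)
  last_eq_zero : R n = 0
  total_eq_one : ∑ k ∈ Finset.Icc 1 n, R k = 1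

/-- `LorenzLE n R' R`: the vectors have the same total reward, and `R'` exhibits less inequality
than `R` in Lorenz order. -/
def LorenzLE (n : ℕ) (R' R : ℕ → ℝ) : Prop :=
  ∑ i ∈ Finset.Icc 1 n, R' i = ∑ i ∈ Finset.Icc 1 n, R i ∧
    ∀ k ∈ Finset.Icc 1 n, ∑ i ∈ Finset.Icc 1 k, R' i ≤ ∑ i ∈ Finset.Icc 1 k, R i

/-- The winner-takes-all scheme: everything goes to the first rank. -/
def winnerTakesAll : ℕ → ℝ := fun k => if k = 1 then 1 else 0

/-- The uniform scheme: `R₁ = … = Rₙ₋₁` (and `Rₙ = 0`). -/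
def uniformScheme (n : ℕ) : ℕ → ℝ := fun k => if k < n then 1 / ((n : ℝ) - 1) else 0

/-- The average reward. -/
def averageReward (n : ℕ) (R : ℕ → ℝ) : ℝ := (∑ k ∈ Finset.Icc 1 n, R k) / n

/-- The critical drift below which the game with rewards `R` has an equilibrium in which the
players stop within a bounded range of levels. -/
def criticalDrift (n : ℕ) (R : ℕ → ℝ) (x₀ σ : ℝ) : ℝ :=
  σ ^ 2 / (2 * x₀) * Real.log ((R 1 - R n) / (R 1 - averageReward n R))

/-! ### The private diffusions and the stopping times -/

/-- The process `x₀ + μ t + σ W_t`. -/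
def driftedPath {Ω : Type u} (x₀ μ σ : ℝ) (W : ℝ≥0 → Ω → ℝ) : ℝ≥0 → Ω → ℝ :=
  fun t ω => x₀ + μ * (t : ℝ) + σ * W t ω

open Classical in
/-- The process `Y`, absorbed at the origin. -/
def absorbAtZero {Ω : Type u} (Y : ℝ≥0 → Ω → ℝ) : ℝ≥0 → Ω → ℝ :=
  fun t ω => if ∃ s ≤ t, Y s ω ≤ 0 then 0 else Y t ω

/-- The private diffusion of a player together with a possibly randomized stopping time: on some
filtered probability space, a Brownian motion `W` relative to the filtration and an almost surely
finite stopping time `τ`. The filtration may be larger than the one generated by `W`, as long as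
the future increments of `W` are independent of it; this is the randomization. -/
structure Play where
  /-- The sample space. -/
  Ω : Type u
  /-- The events. -/
  mΩ : MeasurableSpace Ω
  /-- The probability measure. -/
  P : Measure Ω
  /-- The information available to the player. -/
  ℱ : Filtration ℝ≥0 mΩ
  /-- The standard Brownian motion. -/
  W : ℝ≥0 → Ω → ℝ
  /-- The stopping time. -/
  τ : Ω → WithTop ℝ≥0
  isProbabilityMeasure : IsProbabilityMeasure P
  isBrownian : IsBrownianReal W P
  adapted : ∀ t, Measurable[ℱ t] (W t)
  indep_increments : ∀ s t, s ≤ t →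
    Indep (MeasurableSpace.comap (fun ω => W t ω - W s ω) inferInstance) (ℱ s) P
  isStoppingTime : IsStoppingTime ℱ τ
  finite : ∀ᵐ ω ∂P, τ ω ≠ ⊤

namespace Play

/-- The level `X_τ` at which the player stops, `X` being `x₀ + μ t + σ W_t` absorbed at `0`. -/
def level (S : Play.{u}) (x₀ μ σ : ℝ) : S.Ω → ℝ :=
  stoppedValue (absorbAtZero (driftedPath x₀ μ σ S.W)) S.τ

/-- The distribution of the stopping level. -/
def law (S : Play.{u}) (x₀ μ σ : ℝ) : Measure ℝ :=
  @Measure.map S.Ω ℝ S.mΩ _ (S.level x₀ μ σ) S.P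

/-- The expected duration `E[τ]`, in `[0, ∞]`. -/
def duration (S : Play.{u}) : ℝ≥0∞ :=
  @lintegral S.Ω S.mΩ S.P (fun ω => (S.τ ω : ℝ≥0∞))

end Play

/-- The feasible distributions: those of the stopping levels that a player can achieve. -/
def Feasible (x₀ μ σ : ℝ) (F : Measure ℝ) : Prop :=
  ∃ S : Play.{0}, S.law x₀ μ σ = F

/-! ### The game -/

open Classical in
/-- The reward of a player stopping at level `x` when the others stop at the levels `y`, averaged
over the uniform tie-breaking: if `i` of the others are above `x` and `k` are at `x`, it is the
average of the rewards at the ranks `i + 1, …, i + k + 1`. -/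
def rankReward {n : ℕ} (R : ℕ → ℝ) (x : ℝ) (y : Fin (n - 1) → ℝ) : ℝ :=
  let i := (Finset.univ.filter fun j => x < y j).card
  let k := (Finset.univ.filter fun j => y j = x).card
  (∑ r ∈ Finset.Icc (i + 1) (i + k + 1), R r) / ((k : ℝ) + 1)

/-- The expected payoff of a player stopping at level `x` when the `n - 1` others stop
independently at levels distributed according to `F`. -/
def expectedPayoff (n : ℕ) (R : ℕ → ℝ) (F : Measure ℝ) (x : ℝ) : ℝ :=
  ∫ y, rankReward R x y ∂(Measure.pi fun _ : Fin (n - 1) => F)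

/-- `F` is an equilibrium distribution: it is feasible, and no player gains by deviating to
another feasible distribution when the others use `F`. -/
def IsEquilibrium (n : ℕ) (R : ℕ → ℝ) (x₀ μ σ : ℝ) (F : Measure ℝ) : Prop :=
  Feasible x₀ μ σ F ∧ ∀ G, Feasible x₀ μ σ G →
    ∫ x, expectedPayoff n R F x ∂G ≤ ∫ x, expectedPayoff n R F x ∂F

/-- The stopping time of `S` is an equilibrium stopping time for the reward scheme `R`. -/
def Play.IsEquilibriumPlay (S : Play.{u}) (n : ℕ) (R : ℕ → ℝ) (x₀ μ σ : ℝ) : Prop :=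
  IsEquilibrium n R x₀ μ σ (S.law x₀ μ σ)

end

end RankGame

/-! Let `s` be the scale function of the diffusion with `s 0 = 0`. Stopped at absorption, `s (X)` is
a nonnegative martingale, so by Fatou every feasible law `F` satisfies `∫ s dF ≤ s x₀`. In
equilibrium with value `V`, testing against immediate stopping and against exit laws of intervals
shows that the payoff `u` lies below a line `V + β (s - s x₀)` with `β ≥ 0`
(`IsEquilibrium.exists_slope`). Integrating this bound against `F` gives `V ≤ V + β (∫ s dF - s x₀)
≤ V`, so `u` equals the line `F`-almost everywhere.

This pins down the equilibrium law (`IsEquilibrium.structure`). An atom of `F` would make `u` jump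
above the continuous line, so `F` is atomless and `u` is the Bernstein-type polynomial `φ_R =
quantileReward (n - 1) R` of the quantile, which is uniformly distributed. Hence `V = 1 / n`. Since
the last reward is `0`, the line passes through the origin, and `s x = n * s x₀ * φ_R (F x)` almost
everywhere; moreover `β > 0` forces `∫ s dF = s x₀`.

The drift bound says that `n * s x₀ * R 1` is below some value of `s`, so equilibrium levels are
bounded and equality in the mean prevents the path from leaving a bounded range before it is stopped
(`Play.duration_eq`). With `p` such that `p (X_t) - t` is a martingale up to absorption, optional
stopping gives `E[τ] = ∫₀¹ G (n * s x₀ * φ_R q) dq - p x₀`, where `G = p ∘ s⁻¹` is convex.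

Lorenz monotonicity is then a convex order statement. The tangent inequality for `G` along the less
unequal scheme reduces it to `∫ h (φ_R - φ_R') ≥ 0` for monotone `h`. Abel summation turns this into
nonnegative combinations of integrals of `h` against differences of neighbouring rank weights, each
of which has mean zero and changes sign once (`integral_comp_quantileReward_le`). -/

namespace RankGame

open Filter Topology

/-! ### Optional stopping in continuous time -/

section OptionalStopping

variable {Ω : Type*} {mΩ : MeasurableSpace Ω} {P : Measure Ω} {ℱ : Filtration ℝ≥0 mΩ}

lemma untopA_coe (t : ℝ≥0) : (t : WithTop ℝ≥0).untopA = t := rfl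

lemma coe_untopA {r : WithTop ℝ≥0} (h : r ≠ ⊤) : ((r.untopA : ℝ≥0) : WithTop ℝ≥0) = r := by
  lift r to ℝ≥0 using h
  rfl

/-- Rounding up to the next point of a grid of mesh `1 / (k + 1)`. -/
noncomputable def gridCeil (k : ℕ) (x : ℝ≥0) : ℝ≥0 := (⌊(k + 1) * x⌋₊ + 1) / (k + 1)

/-- Rounding is strict, even at grid points; the comparison therefore becomes a strict inequality
with the last grid point not after `i`. -/
lemma gridCeil_le_iff (k : ℕ) (x i : ℝ≥0) :
    gridCeil k x ≤ i ↔ x < ⌊(k + 1) * i⌋₊ / (k + 1) := by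
  have hk : (0 : ℝ≥0) < k + 1 := by positivity
  rw [gridCeil, div_le_iff₀ hk, lt_div_iff₀ hk, mul_comm i, mul_comm x]
  have h1 : ((⌊(k + 1) * x⌋₊ : ℝ≥0) + 1) = ((⌊(k + 1) * x⌋₊ + 1 : ℕ) : ℝ≥0) := by push_cast; rfl
  rw [h1, ← Nat.le_floor_iff (by positivity), Nat.succ_le_iff, Nat.floor_lt (by positivity)]

lemma floor_div_le (k : ℕ) (i : ℝ≥0) : (⌊(k + 1) * i⌋₊ : ℝ≥0) / (k + 1) ≤ i := by
  have hk : (0 : ℝ≥0) < k + 1 := by positivity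
  rw [div_le_iff₀ hk, mul_comm i]
  exact Nat.floor_le (by positivity)

lemma tendsto_gridCeil (x : ℝ≥0) : Tendsto (fun k => gridCeil k x) atTop (𝓝 x) := by
  have h0 : Tendsto (fun k : ℕ => x + 1 / ((k : ℝ≥0) + 1)) atTop (𝓝 (x + 0)) :=
    tendsto_const_nhds.add tendsto_one_div_add_atTop_nhds_zero_nat
  rw [add_zero] at h0
  refine tendsto_of_tendsto_of_tendsto_of_le_of_le tendsto_const_nhds h0 (fun k => ?_)
    (fun k => ?_)
  · by_contra h
    have := (gridCeil_le_iff k x x).1 (not_le.1 h).le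
    exact absurd (floor_div_le k x) (not_le.2 this)
  · have hk : (0 : ℝ≥0) < k + 1 := by positivity
    simp only [gridCeil]
    rw [add_div]
    gcongr
    exact floor_div_le k x

/-- For `i < T` the event in question is `τ < g`, with `g` the last grid point up to `i`, and this
is known at time `g`. The outer minimum is needed because rounding up may overshoot `T`. -/
lemma isStoppingTime_min_gridCeil {τ : Ω → WithTop ℝ≥0} (hτ : IsStoppingTime ℱ τ) (k : ℕ)
    {T : ℝ≥0} :
    IsStoppingTime ℱ fun ω => ((min T (gridCeil k (min (T : WithTop ℝ≥0) (τ ω)).untopA) : ℝ≥0) :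
      WithTop ℝ≥0) := by
  intro i
  by_cases hT : T ≤ i
  · convert MeasurableSet.univ
    ext ω
    simp only [Set.mem_ofPred_eq, WithTop.coe_le_coe, inf_le_iff, hT, true_or, Set.mem_univ]
  · have : {ω | ((min T (gridCeil k (min (T : WithTop ℝ≥0) (τ ω)).untopA) : ℝ≥0) :
        WithTop ℝ≥0) ≤ i} = {ω | τ ω < ((⌊(k + 1) * i⌋₊ / (k + 1) : ℝ≥0) : WithTop ℝ≥0)} := by
      ext ω
      have hle := (floor_div_le k i).trans (not_le.1 hT).le
      simp only [Set.mem_ofPred_eq, WithTop.coe_le_coe, inf_le_iff, hT, false_or, gridCeil_le_iff]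
      cases h : τ ω with
      | top =>
        rw [min_eq_left le_top, untopA_coe]
        exact ⟨fun h => absurd (h.trans_le hle) (lt_irrefl _), fun h => absurd h not_top_lt⟩
      | coe t =>
        rw [← WithTop.coe_min, untopA_coe, WithTop.coe_lt_coe, min_lt_iff]
        simp [not_lt.2 hle]
    rw [this]
    exact ℱ.mono (floor_div_le k i) _ (hτ.measurableSet_lt _)

/-- Optional stopping for a martingale with continuous paths. -/
theorem _root_.MeasureTheory.Martingale.integrable_integral_stopped [IsProbabilityMeasure P]
    {M : ℝ≥0 → Ω → ℝ} (hM : Martingale M ℱ P) (hc : ∀ ω, Continuous fun t => M t ω)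
    {τ : Ω → WithTop ℝ≥0} (hτ : IsStoppingTime ℱ τ) (T : ℝ≥0) :
    Integrable (stoppedProcess M τ T) P ∧
      ∫ ω, stoppedProcess M τ T ω ∂P = ∫ ω, M 0 ω ∂P := by
  set ρ : ℕ → Ω → WithTop ℝ≥0 := fun k ω =>
    ((min T (gridCeil k (min (T : WithTop ℝ≥0) (τ ω)).untopA) : ℝ≥0) : WithTop ℝ≥0) with hρ
  have hρs k : IsStoppingTime ℱ (ρ k) := isStoppingTime_min_gridCeil hτ k
  have hρle k ω : ρ k ω ≤ T := WithTop.coe_le_coe.2 (min_le_left _ _)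
  have hcount k : (Set.range (ρ k)).Countable := by
    refine Set.Countable.mono (s₂ := Set.range fun j : ℕ =>
      ((min T ((j + 1) / (k + 1)) : ℝ≥0) : WithTop ℝ≥0)) ?_ (Set.countable_range _)
    rintro _ ⟨ω, rfl⟩
    exact ⟨_, rfl⟩
  -- Conditional expectations of the single variable `M T` are uniformly integrable; this upgrades
  -- the pathwise convergence along the grids to convergence in `L¹`.
  have hce k : stoppedValue M (ρ k) =ᵐ[P] P[M T | (hρs k).measurableSpace] :=
    hM.stoppedValue_ae_eq_condExp_of_le_const_of_countable_range (hρs k) (hρle k) (hcount k)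
  have hUI : UniformIntegrable (fun k => stoppedValue M (ρ k)) 1 P :=
    ((hM.integrable T).uniformIntegrable_condExp
      (fun k => (hρs k).measurableSpace_le)).ae_eq fun k => (hce k).symm
  have hlim : ∀ᵐ ω ∂P, Tendsto (fun k => stoppedValue M (ρ k) ω) atTop
      (𝓝 (stoppedProcess M τ T ω)) := by
    refine ae_of_all _ fun ω => ?_
    simp only [stoppedValue, stoppedProcess, hρ, untopA_coe]
    refine ((hc ω).tendsto _).comp ?_
    have h1 := (tendsto_const_nhds (x := T)).min
      (tendsto_gridCeil (min (T : WithTop ℝ≥0) (τ ω)).untopA)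
    rwa [min_eq_right (WithTop.untopA_le (min_le_left _ _))] at h1
  have hmem : MemLp (stoppedProcess M τ T) 1 P := hUI.memLp_of_ae_tendsto hlim
  refine ⟨memLp_one_iff_integrable.1 hmem, ?_⟩
  have hL1 := tendsto_Lp_finite_of_tendsto_ae le_rfl ENNReal.one_ne_top (fun k => hUI.1 k) hmem
    hUI.2.1 hlim
  have hint k : Integrable (stoppedValue M (ρ k)) P := by
    exact integrable_condExp.congr (hce k).symm
  have h2 := tendsto_integral_of_L1' _ hmem.1 (Eventually.of_forall hint) hL1
  refine tendsto_nhds_unique h2 ?_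
  have h3 k : ∫ ω, stoppedValue M (ρ k) ω ∂P = ∫ ω, M 0 ω ∂P := by
    rw [integral_congr_ae (hce k), integral_condExp (hρs k).measurableSpace_le,
      ← setIntegral_univ, ← setIntegral_univ (f := M 0)]
    exact (hM.setIntegral_eq (zero_le (a := T)) MeasurableSet.univ).symm
  simp only [h3]
  exact tendsto_const_nhds

end OptionalStopping

/-! ### Hitting times of closed sets -/

section Hitting

variable {Ω : Type*} {mΩ : MeasurableSpace Ω} {ℱ : Filtration ℝ≥0 mΩ} {Y : ℝ≥0 → Ω → ℝ}
  {C : Set ℝ}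

/-- The times at which a continuous path is in a closed set form a closed set, so the infimum is
attained. -/
lemma hittingAfter_le_iff_exists (hc : ∀ ω, Continuous fun t => Y t ω) (hC : IsClosed C)
    (ω : Ω) (t : ℝ≥0) : hittingAfter Y C 0 ω ≤ t ↔ ∃ s ≤ t, Y s ω ∈ C := by
  constructor
  · intro h
    by_cases hex : ∃ j, 0 ≤ j ∧ Y j ω ∈ C
    · rw [hittingAfter, if_pos hex, WithTop.coe_le_coe] at h
      have hcl : IsClosed {i : ℝ≥0 | 0 ≤ i ∧ Y i ω ∈ C} := by
        simp only [zero_le, true_and]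
        exact hC.preimage (hc ω)
      exact ⟨_, h, (hcl.csInf_mem hex (OrderBot.bddBelow _)).2⟩
    · rw [hittingAfter, if_neg hex] at h
      exact absurd h (not_le.2 (WithTop.coe_lt_top t))
  · rintro ⟨s, hs, hY⟩
    exact (hittingAfter_le_of_mem zero_le hY).trans (WithTop.coe_le_coe.2 hs)

lemma mem_of_hittingAfter_eq_coe (hc : ∀ ω, Continuous fun t => Y t ω) (hC : IsClosed C)
    {ω : Ω} {t : ℝ≥0} (h : hittingAfter Y C 0 ω = t) : Y t ω ∈ C := by
  obtain ⟨s, hs, hY⟩ := (hittingAfter_le_iff_exists hc hC ω t).1 h.le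
  have := hittingAfter_le_of_mem (zero_le (a := s)) hY
  rw [h, WithTop.coe_le_coe] at this
  rwa [le_antisymm this hs]

/-- By compactness, `C` is hit by time `t` exactly when the distance to `C` has infimum zero on `[0,
t]`, and by continuity countably many times suffice. No right-continuity of `ℱ` is required. -/
lemma isStoppingTime_hittingAfter_of_isClosed (ha : ∀ t, Measurable[ℱ t] (Y t))
    (hc : ∀ ω, Continuous fun t => Y t ω) (hC : IsClosed C) :
    IsStoppingTime ℱ (hittingAfter Y C 0) := by
  intro t
  -- `Metric.infDist` to the empty set is `0`, so this case must be set aside.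
  rcases C.eq_empty_or_nonempty with rfl | hne
  · simp
  let q : ℕ → ℝ≥0 := fun n => min (TopologicalSpace.denseSeq ℝ≥0 n) t
  have : {ω | hittingAfter Y C 0 ω ≤ t} =
      ⋂ k : ℕ, ⋃ n : ℕ, {ω | Metric.infDist (Y (q n) ω) C < 1 / ((k : ℝ) + 1)} := by
    ext ω
    rw [Set.mem_ofPred_eq, hittingAfter_le_iff_exists hc hC]
    simp only [Set.mem_iInter, Set.mem_iUnion, Set.mem_ofPred_eq]
    have hcont : Continuous fun s => Metric.infDist (Y s ω) C :=
      (Metric.continuous_infDist_pt C).comp (hc ω)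
    constructor
    · rintro ⟨s, hs, hY⟩ k
      have hopen : IsOpen {r : ℝ≥0 | Metric.infDist (Y (min r t) ω) C < 1 / ((k : ℝ) + 1)} :=
        isOpen_lt (hcont.comp (continuous_id.min continuous_const)) continuous_const
      obtain ⟨n, hn⟩ := (TopologicalSpace.denseRange_denseSeq ℝ≥0).exists_mem_open hopen
        ⟨s, by
          rw [Set.mem_ofPred_eq, min_eq_left hs, Metric.infDist_zero_of_mem hY]; positivity⟩
      exact ⟨n, hn⟩
    · intro h
      obtain ⟨s, hs, hmin⟩ := (isCompact_Icc (a := (0 : ℝ≥0)) (b := t)).exists_isMinOn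
        ⟨0, by simp⟩ hcont.continuousOn
      refine ⟨s, hs.2, ?_⟩
      rw [hC.mem_iff_infDist_zero hne]
      refine le_antisymm (le_of_forall_pos_lt_add fun ε hε => ?_) Metric.infDist_nonneg
      obtain ⟨k, hk⟩ := exists_nat_one_div_lt hε
      obtain ⟨n, hn⟩ := h k
      have := hmin (a := q n) ⟨zero_le, min_le_right _ _⟩
      simp only [Set.mem_ofPred_eq] at this
      linarith
  rw [this]
  refine MeasurableSet.iInter fun k => MeasurableSet.iUnion fun n => ?_
  have hm : Measurable[ℱ t] (Y (q n)) := (ha (q n)).mono (ℱ.mono (min_le_right _ _)) le_rfl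
  exact measurableSet_lt ((Metric.continuous_infDist_pt C).measurable.comp hm) measurable_const

end Hitting

/-! ### Brownian motion relative to a filtration -/

section Brownian

variable {Ω : Type*} {mΩ : MeasurableSpace Ω}

/-- A Brownian motion relative to `ℱ`, all of whose paths are continuous and start at `0`. -/
structure IsContinuousBrownian (ℱ : Filtration ℝ≥0 mΩ) (W : ℝ≥0 → Ω → ℝ) (P : Measure Ω) :
    Prop where
  continuous : ∀ ω, Continuous fun t => W t ω
  zero : ∀ ω, W 0 ω = 0
  adapted : ∀ t, Measurable[ℱ t] (W t)
  indep_increments : ∀ s t, s ≤ t →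
    Indep (MeasurableSpace.comap (fun ω => W t ω - W s ω) inferInstance) (ℱ s) P
  isBrownian : IsBrownianReal W P

variable {P : Measure Ω} {ℱ : Filtration ℝ≥0 mΩ} {W : ℝ≥0 → Ω → ℝ}

namespace IsContinuousBrownian

lemma measurable (hW : IsContinuousBrownian ℱ W P) (t : ℝ≥0) : Measurable (W t) :=
  (hW.adapted t).mono (ℱ.le t) le_rfl

lemma hasLaw_sub (hW : IsContinuousBrownian ℱ W P) (s t : ℝ≥0) (h : s ≤ t) :
    HasLaw (fun ω => W t ω - W s ω) (gaussianReal 0 (t - s)) P := by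
  have := hW.isBrownian.hasLaw_sub t s
  have hd : nndist t.1 s.1 = t - s := by
    ext
    rw [coe_nndist, Real.dist_eq, NNReal.coe_sub h, abs_of_nonneg]
    · rfl
    · exact sub_nonneg.2 (NNReal.coe_le_coe.2 h)
  rwa [hd] at this

lemma hasLaw (hW : IsContinuousBrownian ℱ W P) (t : ℝ≥0) :
    HasLaw (W t) (gaussianReal 0 t) P := by
  simpa [hW.zero] using hW.hasLaw_sub 0 t zero_le

lemma integrable_comp_sub (hW : IsContinuousBrownian ℱ W P) {s t : ℝ≥0} (h : s ≤ t) {f : ℝ → ℝ}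
    (hf : Integrable f (gaussianReal 0 (t - s))) : Integrable (fun ω => f (W t ω - W s ω)) P := by
  have := hW.hasLaw_sub s t h
  rw [← this.map_eq] at hf
  exact hf.comp_aemeasurable this.aemeasurable

lemma integrable_comp (hW : IsContinuousBrownian ℱ W P) {t : ℝ≥0} {f : ℝ → ℝ}
    (hf : Integrable f (gaussianReal 0 t)) : Integrable (fun ω => f (W t ω)) P := by
  have := hW.hasLaw t
  rw [← this.map_eq] at hf
  exact hf.comp_aemeasurable this.aemeasurable

lemma memLp_two (hW : IsContinuousBrownian ℱ W P) (t : ℝ≥0) : MemLp (W t) 2 P := by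
  have h := hW.hasLaw t
  have h2 : MemLp id 2 (gaussianReal 0 t) := memLp_id_gaussianReal 2
  rw [← h.map_eq] at h2
  exact h2.comp_of_map h.aemeasurable

variable [IsProbabilityMeasure P]

/-- The conditional expectation of a function of an increment. -/
lemma condExp_comp_sub (hW : IsContinuousBrownian ℱ W P) {s t : ℝ≥0} (h : s ≤ t) {f : ℝ → ℝ}
    (hf : Measurable f) :
    P[fun ω => f (W t ω - W s ω) | ℱ s] =ᵐ[P] fun _ => ∫ x, f x ∂gaussianReal 0 (t - s) := by
  have hle : MeasurableSpace.comap (fun ω => W t ω - W s ω) inferInstance ≤ mΩ :=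
    ((hW.measurable t).sub (hW.measurable s)).comap_le
  have hm : StronglyMeasurable[MeasurableSpace.comap (fun ω => W t ω - W s ω) inferInstance]
      (fun ω => f (W t ω - W s ω)) :=
    (hf.comp (comap_measurable _)).stronglyMeasurable
  refine (condExp_indep_eq hle (ℱ.le s) hm (hW.indep_increments s t h)).trans ?_
  refine ae_of_all _ fun _ => ?_
  exact (hW.hasLaw_sub s t h).integral_comp hf.aestronglyMeasurable

/-- A product decomposition of the conditional expectation given the past. -/
lemma condExp_mul_comp_sub (hW : IsContinuousBrownian ℱ W P) {s t : ℝ≥0} (h : s ≤ t)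
    {f g : ℝ → ℝ} (hf : Measurable f) (hg : Measurable g)
    (hgi : Integrable g (gaussianReal 0 (t - s)))
    (hfg : Integrable (fun ω => f (W s ω) * g (W t ω - W s ω)) P) :
    P[fun ω => f (W s ω) * g (W t ω - W s ω) | ℱ s] =ᵐ[P]
      fun ω => f (W s ω) * ∫ x, g x ∂gaussianReal 0 (t - s) := by
  have h1 := condExp_mul_of_stronglyMeasurable_left (m := ℱ s) (μ := P)
    (f := fun ω => f (W s ω)) (g := fun ω => g (W t ω - W s ω))
    (hf.comp (hW.adapted s)).stronglyMeasurable hfg (hW.integrable_comp_sub h hgi)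
  refine h1.trans ?_
  filter_upwards [hW.condExp_comp_sub h hg] with ω hω
  simp [hω]

theorem martingale (hW : IsContinuousBrownian ℱ W P) : Martingale W ℱ P := by
  refine ⟨fun t => (hW.adapted t).stronglyMeasurable, fun s t h => ?_⟩
  have hi (t) : Integrable (W t) P := (hW.memLp_two t).integrable (by norm_num)
  have h0 : W t = W s + fun ω => id (W t ω - W s ω) := by ext; simp
  have h1 : Integrable (fun ω => id (W t ω - W s ω)) P := (hi t).sub (hi s)
  rw [h0]
  refine (condExp_add (hi s) h1 _).trans ?_
  rw [condExp_of_stronglyMeasurable (ℱ.le s) (hW.adapted s).stronglyMeasurable (hi s)]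
  filter_upwards [hW.condExp_comp_sub h measurable_id] with ω hω
  rw [Pi.add_apply, hω]
  simp only [id_eq, integral_id_gaussianReal, add_zero]

lemma integrable_sq_gaussianReal (v : ℝ≥0) :
    Integrable (fun x : ℝ => x ^ 2) (gaussianReal 0 v) :=
  (memLp_id_gaussianReal 2).integrable_sq

lemma integral_sq_gaussianReal (v : ℝ≥0) : ∫ x, x ^ 2 ∂gaussianReal 0 v = v := by
  have h := variance_id_gaussianReal (μ := 0) (v := v)
  rw [variance_eq_integral aemeasurable_id] at h
  simpa using h

/-- In the expansion of `W t ^ 2` around `W s`, the cross term has conditional mean zero and the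
squared increment has mean `t - s`. -/
theorem martingale_sq_sub (hW : IsContinuousBrownian ℱ W P) :
    Martingale (fun t ω => W t ω ^ 2 - t) ℱ P := by
  refine ⟨fun t => (((hW.adapted t).pow_const 2).sub_const _).stronglyMeasurable,
    fun s t h => ?_⟩
  have hi : Integrable (fun ω => W s ω ^ 2 - s) P :=
    (hW.memLp_two s).integrable_sq.sub (integrable_const _)
  have hid : Integrable (fun x : ℝ => x) (gaussianReal 0 (t - s)) :=
    (memLp_id_gaussianReal 2).integrable (by norm_num)
  have hprod : Integrable (fun ω => 2 * W s ω * (W t ω - W s ω)) P := by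
    exact (hW.memLp_two s |>.const_mul 2).integrable_mul ((hW.memLp_two t).sub (hW.memLp_two s))
  have hsq := hW.integrable_comp_sub h (integrable_sq_gaussianReal (t - s))
  have h0 : (fun ω => W t ω ^ 2 - (t : ℝ)) = (fun ω => W s ω ^ 2 - (s : ℝ)) +
      (fun ω => 2 * W s ω * (W t ω - W s ω)) + (fun ω => (W t ω - W s ω) ^ 2) +
      fun _ => ((s : ℝ) - t) := by
    ext; simp; ring
  change P[fun ω => W t ω ^ 2 - (t : ℝ) | ℱ s] =ᵐ[P] _
  rw [h0]
  refine (condExp_add ((hi.add hprod).add hsq) (integrable_const _) _).trans ?_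
  rw [condExp_const (ℱ.le s)]
  have h1 := condExp_add (hi.add hprod) hsq (ℱ s)
  have h2 := condExp_add hi hprod (ℱ s)
  rw [condExp_of_stronglyMeasurable (ℱ.le s)
    (((hW.adapted s).pow_const 2).sub_const _).stronglyMeasurable hi] at h2
  filter_upwards [h1, h2, hW.condExp_comp_sub h (measurable_id.pow_const 2),
    hW.condExp_mul_comp_sub h (f := fun x => 2 * x) (g := fun x => x)
      (measurable_id.const_mul 2) measurable_id hid hprod] with ω h1 h2 h3 h4
  simp only [id_eq, integral_sq_gaussianReal] at h3
  simp only [Pi.add_apply] at h1 h2 ⊢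
  rw [h1, h2, h3, h4, integral_id_gaussianReal, NNReal.coe_sub h]
  ring

theorem martingale_exp (hW : IsContinuousBrownian ℱ W P) (l : ℝ) :
    Martingale (fun t ω => Real.exp (l * W t ω - l ^ 2 / 2 * t)) ℱ P := by
  have hmeas (t : ℝ≥0) : Measurable fun x : ℝ => Real.exp (l * x - l ^ 2 / 2 * t) := by fun_prop
  have hi (t : ℝ≥0) : Integrable (fun ω => Real.exp (l * W t ω - l ^ 2 / 2 * t)) P := by
    refine hW.integrable_comp (f := fun x => Real.exp (l * x - l ^ 2 / 2 * t)) ?_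
    simp_rw [sub_eq_add_neg, Real.exp_add]
    exact (integrable_exp_mul_gaussianReal l).mul_const _
  refine ⟨fun t => ((hmeas t).comp (hW.adapted t)).stronglyMeasurable, fun s t h => ?_⟩
  let g : ℝ → ℝ := fun x => Real.exp (l * x)
  have hg : Measurable g := by fun_prop
  have hgi : Integrable g (gaussianReal 0 (t - s)) := integrable_exp_mul_gaussianReal l
  let f : ℝ → ℝ := fun x => Real.exp (l * x - l ^ 2 / 2 * t)
  have h0 : (fun ω => Real.exp (l * W t ω - l ^ 2 / 2 * t)) =
      fun ω => f (W s ω) * g (W t ω - W s ω) := by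
    ext ω
    simp only [f, g, ← Real.exp_add]
    ring_nf
  have hint := hi t
  rw [h0] at hint
  change P[fun ω => Real.exp (l * W t ω - l ^ 2 / 2 * t) | ℱ s] =ᵐ[P] _
  rw [h0]
  refine (hW.condExp_mul_comp_sub h (hmeas t) hg hgi hint).trans (ae_of_all _ fun ω => ?_)
  have hmgf : ∫ x, g x ∂gaussianReal 0 (t - s) = Real.exp (l ^ 2 / 2 * (t - s)) := by
    have := congr_fun (mgf_id_gaussianReal (μ := 0) (v := t - s)) l
    simp only [mgf, id_eq, zero_mul, zero_add, NNReal.coe_sub h] at this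
    rw [this]
    ring_nf
  simp only [hmgf, ← Real.exp_add]
  ring_nf

end IsContinuousBrownian

/-- Every Brownian motion relative to a filtration can be modified on a null set so that all its
paths are continuous and start at `0`; the filtration has to be enlarged by null sets. -/
theorem exists_isContinuousBrownian [IsProbabilityMeasure P] (ℱ : Filtration ℝ≥0 mΩ) (hB : IsBrownianReal W P)
    (ha : ∀ t, Measurable[ℱ t] (W t))
    (hi : ∀ s t, s ≤ t →
      Indep (MeasurableSpace.comap (fun ω => W t ω - W s ω) inferInstance) (ℱ s) P) :
    ∃ (ℱ' : Filtration ℝ≥0 mΩ) (W' : ℝ≥0 → Ω → ℝ), ℱ ≤ ℱ' ∧ IsContinuousBrownian ℱ' W' P ∧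
      ∀ᵐ ω ∂P, ∀ t, W' t ω = W t ω := by
  -- The exceptional null set enters every `ℱ' t`, so setting the path to `0` on it preserves
  -- adaptedness. The intersection with `mΩ` keeps `ℱ'` inside the given events.
  let ℱ' : Filtration ℝ≥0 mΩ :=
    { seq := fun t => eventuallyMeasurableSpace (ℱ t) (ae P) ⊓ mΩ
      mono' := fun s t h A hA => by
        obtain ⟨⟨B, hB, hAB⟩, hA'⟩ := MeasurableSpace.measurableSet_inf.1 hA
        exact MeasurableSpace.measurableSet_inf.2 ⟨⟨B, ℱ.mono h _ hB, hAB⟩, hA'⟩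
      le' := fun t => inf_le_right }
  have hgood : ∀ᵐ ω ∂P, Continuous (W · ω) ∧ W 0 ω = 0 :=
    hB.cont.and hB.eval_zero_ae_eq_zero
  obtain ⟨A, hsub, hA, hA0⟩ := exists_measurable_superset_of_null (ae_iff.1 hgood)
  have hA_good : ∀ ω ∉ A, Continuous (W · ω) ∧ W 0 ω = 0 := fun ω hω => by
    by_contra h
    exact hω (hsub h)
  have hAc : ∀ᵐ ω ∂P, ω ∉ A := by
    rw [ae_iff]
    simpa using hA0
  classical
  let W' : ℝ≥0 → Ω → ℝ := fun t ω => if ω ∈ A then 0 else W t ω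
  have hWW : ∀ᵐ ω ∂P, ∀ t, W' t ω = W t ω := by
    filter_upwards [hAc] with ω hω t
    simp [W', hω]
  have hAm (t) : MeasurableSet[ℱ' t] A := by
    refine MeasurableSpace.measurableSet_inf.2 ⟨?_, hA⟩
    exact ⟨∅, @MeasurableSet.empty _ (ℱ t), by rw [ae_eq_empty]; exact hA0⟩
  have hle : ℱ ≤ ℱ' := fun t B hB =>
    MeasurableSpace.measurableSet_inf.2 ⟨⟨B, hB, EventuallyEq.rfl⟩, ℱ.le t _ hB⟩
  refine ⟨ℱ', W', hle, ⟨fun ω => ?_, fun ω => ?_, fun t => ?_, fun s t h => ?_, ?_⟩, hWW⟩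
  · by_cases hω : ω ∈ A
    · simp [W', hω, continuous_const]
    · simpa [W', hω] using (hA_good ω hω).1
  · by_cases hω : ω ∈ A
    · simp [W', hω]
    · simpa [W', hω] using (hA_good ω hω).2
  · exact Measurable.ite (hAm t) measurable_const ((ha t).mono (hle t) le_rfl)
  -- Events of `ℱ' s` and of the new increments differ from old ones by null sets, so independence
  -- carries over.
  · rw [Indep_iff]
    rintro _ B ⟨D, hD, rfl⟩ hBm
    obtain ⟨⟨B', hB', hBB⟩, -⟩ := MeasurableSpace.measurableSet_inf.1 hBm
    have h1 : ((fun ω => W' t ω - W' s ω) ⁻¹' D : Set Ω) =ᵐ[P]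
        ((fun ω => W t ω - W s ω) ⁻¹' D : Set Ω) := by
      rw [eventuallyEq_set]
      filter_upwards [hWW] with ω hω
      simp [hω]
    rw [measure_congr (h1.inter hBB), measure_congr h1, measure_congr hBB]
    exact (Indep_iff _ _ P).1 (hi s t h) _ _ ⟨D, hD, rfl⟩ hB'
  · refine ⟨hB.toIsPreBrownianReal.congr fun t => ?_, ?_⟩
    · filter_upwards [hWW] with ω hω using (hω t).symm
    · filter_upwards [hWW, hB.cont] with ω hω hc
      simpa [hω] using hc

end Brownian

/-! ### The scale function and the potential of the diffusion -/

section Scale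

/-- The scale function of `x₀ + μ t + σ W_t` that vanishes at `0`. -/
noncomputable def scale (μ σ x : ℝ) : ℝ :=
  if μ = 0 then x else (1 - Real.exp (-(2 * μ / σ ^ 2) * x)) / (2 * μ / σ ^ 2)

/-- A function whose value along `x₀ + μ t + σ W_t` grows in the mean like `t`. -/
noncomputable def potential (μ σ x : ℝ) : ℝ := if μ = 0 then x ^ 2 / σ ^ 2 else x / μ

lemma scale_zero (μ σ : ℝ) : scale μ σ 0 = 0 := by
  simp [scale]

lemma continuous_scale (μ σ : ℝ) : Continuous (scale μ σ) := by
  unfold scale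
  split_ifs <;> fun_prop

lemma continuous_potential (μ σ : ℝ) : Continuous (potential μ σ) := by
  unfold potential
  split_ifs <;> fun_prop

lemma strictMono_scale (μ : ℝ) {σ : ℝ} (hσ : 0 < σ) : StrictMono (scale μ σ) := by
  intro x y hxy
  unfold scale
  split_ifs with h
  · exact hxy
  · rcases lt_or_gt_of_ne h with h | h
    · have hθ : 2 * μ / σ ^ 2 < 0 := div_neg_of_neg_of_pos (by linarith) (by positivity)
      refine div_lt_div_of_neg_of_lt hθ (sub_lt_sub_left (Real.exp_lt_exp.2 ?_) _)
      nlinarith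
    · have hθ : 0 < 2 * μ / σ ^ 2 := by positivity
      refine div_lt_div_of_pos_right (sub_lt_sub_left (Real.exp_lt_exp.2 ?_) _) hθ
      nlinarith

end Scale

/-! ### The drifted Brownian motion, stopped -/

section Drifted

variable {Ω : Type*} {mΩ : MeasurableSpace Ω} {P : Measure Ω} {ℱ : Filtration ℝ≥0 mΩ}
  {W : ℝ≥0 → Ω → ℝ}

lemma stoppedProcess_eq_of_le {Y : ℝ≥0 → Ω → ℝ} {ρ : Ω → WithTop ℝ≥0} {ω : Ω} {t : ℝ≥0}
    (h : ρ ω ≤ t) : stoppedProcess Y ρ t ω = stoppedValue Y ρ ω := by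
  rw [stoppedProcess, stoppedValue, min_eq_right h]

lemma tendsto_stoppedProcess {Y : ℝ≥0 → Ω → ℝ} {ρ : Ω → WithTop ℝ≥0} {ω : Ω}
    (h : ρ ω ≠ ⊤) :
    Tendsto (fun n : ℕ => stoppedProcess Y ρ n ω) atTop (𝓝 (stoppedValue Y ρ ω)) := by
  lift ρ ω to ℝ≥0 using h with t ht
  obtain ⟨N, hN⟩ := exists_nat_ge t
  refine tendsto_const_nhds.congr' ?_
  filter_upwards [eventually_ge_atTop N] with n hn
  refine (stoppedProcess_eq_of_le ?_).symm
  rw [← ht, WithTop.coe_le_coe]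
  exact hN.trans (by exact_mod_cast hn)

lemma stoppedProcess_mem {Y : ℝ≥0 → Ω → ℝ} {ρ : Ω → WithTop ℝ≥0} {ω : Ω} {A : Set ℝ}
    (h : ∀ t : ℝ≥0, (t : WithTop ℝ≥0) ≤ ρ ω → Y t ω ∈ A) (t : ℝ≥0) :
    stoppedProcess Y ρ t ω ∈ A := by
  refine h _ ?_
  rw [coe_untopA (ne_top_of_le_ne_top WithTop.coe_ne_top (min_le_left _ _))]
  exact min_le_right _ _

lemma stoppedValue_mem {Y : ℝ≥0 → Ω → ℝ} {ρ : Ω → WithTop ℝ≥0} {ω : Ω} {A : Set ℝ}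
    (h : ∀ t : ℝ≥0, (t : WithTop ℝ≥0) ≤ ρ ω → Y t ω ∈ A) (hρ : ρ ω ≠ ⊤) :
    stoppedValue Y ρ ω ∈ A :=
  h _ (coe_untopA hρ).le

variable {x₀ μ σ : ℝ}

namespace IsContinuousBrownian

lemma continuous_driftedPath (hW : IsContinuousBrownian ℱ W P) (x₀ μ σ : ℝ) (ω : Ω) :
    Continuous fun t => driftedPath x₀ μ σ W t ω := by
  have := hW.continuous ω
  unfold driftedPath
  fun_prop

lemma driftedPath_zero (hW : IsContinuousBrownian ℱ W P) (x₀ μ σ : ℝ) (ω : Ω) :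
    driftedPath x₀ μ σ W 0 ω = x₀ := by
  simp [driftedPath, hW.zero]

lemma measurable_driftedPath (hW : IsContinuousBrownian ℱ W P) (x₀ μ σ : ℝ) (t : ℝ≥0) :
    Measurable[ℱ t] (driftedPath x₀ μ σ W t) :=
  ((hW.adapted t).const_mul σ).const_add _

lemma measurable_stoppedProcess (hW : IsContinuousBrownian ℱ W P) (x₀ μ σ : ℝ)
    {ρ : Ω → WithTop ℝ≥0} (hρ : IsStoppingTime ℱ ρ) (t : ℝ≥0) :
    Measurable (stoppedProcess (driftedPath x₀ μ σ W) ρ t) :=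
  (StronglyAdapted.stronglyMeasurable_stoppedProcess
    (fun t => (hW.measurable_driftedPath x₀ μ σ t).stronglyMeasurable)
    (hW.continuous_driftedPath x₀ μ σ) hρ t).measurable

lemma measurable_stoppedValue (hW : IsContinuousBrownian ℱ W P) (x₀ μ σ : ℝ)
    {ρ : Ω → WithTop ℝ≥0} (hρ : IsStoppingTime ℱ ρ) :
    Measurable (stoppedValue (driftedPath x₀ μ σ W) ρ) :=
  (MeasureTheory.measurable_stoppedValue
    (StronglyAdapted.isStronglyProgressive_of_continuous
      (fun t => (hW.measurable_driftedPath x₀ μ σ t).stronglyMeasurable)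
      (hW.continuous_driftedPath x₀ μ σ)) hρ).mono hρ.measurableSpace_le le_rfl

variable [IsProbabilityMeasure P]

/-- For `μ ≠ 0` this is an affine function of the exponential martingale with exponent `l = -2μ/σ`,
whose compensator `l² t / 2` matches the drift contribution. -/
theorem martingale_scale (hW : IsContinuousBrownian ℱ W P) (x₀ μ : ℝ) (hσ : 0 < σ) :
    Martingale (fun t ω => scale μ σ (driftedPath x₀ μ σ W t ω)) ℱ P := by
  by_cases h : μ = 0
  · have h1 := (martingale_const ℱ P x₀).add (hW.martingale.smul σ)
    convert h1 using 3 with t ω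
    simp [scale, h, driftedPath]
  · have h1 := (martingale_const ℱ P (1 / (2 * μ / σ ^ 2))).sub
      ((hW.martingale_exp (-(2 * μ / σ))).smul
        (Real.exp (-(2 * μ / σ ^ 2) * x₀) / (2 * μ / σ ^ 2)))
    convert h1 using 3 with t ω
    simp only [scale, h, if_false, driftedPath, Pi.sub_apply, Pi.smul_apply, smul_eq_mul]
    rw [sub_div, div_mul_eq_mul_div, ← Real.exp_add]
    congr 3
    field_simp
    ring

theorem martingale_potential_sub (hW : IsContinuousBrownian ℱ W P) (x₀ μ : ℝ) (hσ : 0 < σ) :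
    Martingale (fun t ω => potential μ σ (driftedPath x₀ μ σ W t ω) - t) ℱ P := by
  by_cases h : μ = 0
  · have h1 := ((martingale_const ℱ P (x₀ ^ 2 / σ ^ 2)).add
      (hW.martingale.smul (2 * x₀ / σ))).add hW.martingale_sq_sub
    convert h1 using 3 with t ω
    simp only [potential, h, if_true, driftedPath, Pi.add_apply, Pi.smul_apply, smul_eq_mul]
    field_simp
    ring
  · have h1 := (martingale_const ℱ P (x₀ / μ)).add (hW.martingale.smul (σ / μ))
    convert h1 using 3 with t ω
    simp only [potential, h, if_false, driftedPath, Pi.add_apply, Pi.smul_apply, smul_eq_mul]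
    field_simp
    ring

lemma integral_scale_stoppedProcess (hW : IsContinuousBrownian ℱ W P) (x₀ μ : ℝ) (hσ : 0 < σ)
    {ρ : Ω → WithTop ℝ≥0} (hρ : IsStoppingTime ℱ ρ) (t : ℝ≥0) :
    Integrable (fun ω => scale μ σ (stoppedProcess (driftedPath x₀ μ σ W) ρ t ω)) P ∧
      ∫ ω, scale μ σ (stoppedProcess (driftedPath x₀ μ σ W) ρ t ω) ∂P = scale μ σ x₀ := by
  have h := (hW.martingale_scale x₀ μ hσ).integrable_integral_stopped
    (fun ω => (continuous_scale μ σ).comp (hW.continuous_driftedPath x₀ μ σ ω)) hρ t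
  refine ⟨h.1, h.2.trans ?_⟩
  simp [hW.driftedPath_zero]

/-- Stopping before the absorption at `0` does not increase the mean in the natural scale. -/
theorem lintegral_scale_stoppedValue_le (hW : IsContinuousBrownian ℱ W P) (x₀ μ : ℝ)
    (hσ : 0 < σ) {ρ : Ω → WithTop ℝ≥0} (hρ : IsStoppingTime ℱ ρ) (hfin : ∀ᵐ ω ∂P, ρ ω ≠ ⊤)
    (hpos : ∀ ω, ∀ t : ℝ≥0, t ≤ ρ ω → 0 ≤ driftedPath x₀ μ σ W t ω) :
    ∫⁻ ω, ENNReal.ofReal (scale μ σ (stoppedValue (driftedPath x₀ μ σ W) ρ ω)) ∂P ≤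
      ENNReal.ofReal (scale μ σ x₀) := by
  have hlim : ∀ᵐ ω ∂P, Tendsto (fun n : ℕ =>
      ENNReal.ofReal (scale μ σ (stoppedProcess (driftedPath x₀ μ σ W) ρ n ω))) atTop
      (𝓝 (ENNReal.ofReal (scale μ σ (stoppedValue (driftedPath x₀ μ σ W) ρ ω)))) := by
    filter_upwards [hfin] with ω hω
    exact (ENNReal.continuous_ofReal.tendsto _).comp
      (((continuous_scale μ σ).tendsto _).comp (tendsto_stoppedProcess hω))
  -- Fatou along integer times. Only an inequality results, since the stopped martingale need not be
  -- uniformly integrable.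
  calc _ = ∫⁻ ω, liminf (fun n : ℕ => ENNReal.ofReal
        (scale μ σ (stoppedProcess (driftedPath x₀ μ σ W) ρ n ω))) atTop ∂P :=
        lintegral_congr_ae (hlim.mono fun ω h => h.liminf_eq.symm)
    _ ≤ liminf (fun n : ℕ => ∫⁻ ω, ENNReal.ofReal
        (scale μ σ (stoppedProcess (driftedPath x₀ μ σ W) ρ n ω)) ∂P) atTop :=
        lintegral_liminf_le fun n => ENNReal.measurable_ofReal.comp
          ((continuous_scale μ σ).measurable.comp (hW.measurable_stoppedProcess x₀ μ σ hρ n))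
    _ = liminf (fun _ : ℕ => ENNReal.ofReal (scale μ σ x₀)) atTop := by
        congr with n
        obtain ⟨h1, h2⟩ := hW.integral_scale_stoppedProcess x₀ μ hσ hρ n
        rw [← ofReal_integral_eq_lintegral_ofReal h1, h2]
        refine ae_of_all _ fun ω => ?_
        change 0 ≤ scale μ σ _
        rw [← scale_zero μ σ]
        exact (strictMono_scale μ hσ).monotone (stoppedProcess_mem (A := Set.Ici 0) (hpos ω) n)
    _ = _ := by simp

/-- A stopping time up to which the drifted Brownian motion stays bounded has finite mean, and
optional stopping holds for it. -/
theorem optional_stopping_of_bounded (hW : IsContinuousBrownian ℱ W P) (x₀ μ : ℝ) (hσ : 0 < σ)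
    {ρ : Ω → WithTop ℝ≥0} (hρ : IsStoppingTime ℱ ρ) {a b : ℝ}
    (hb : ∀ᵐ ω ∂P, ∀ t : ℝ≥0, t ≤ ρ ω → driftedPath x₀ μ σ W t ω ∈ Set.Icc a b) :
    (∀ᵐ ω ∂P, ρ ω ≠ ⊤) ∧
    ∫ ω, scale μ σ (stoppedValue (driftedPath x₀ μ σ W) ρ ω) ∂P = scale μ σ x₀ ∧
    ∫⁻ ω, (ρ ω : ℝ≥0∞) ∂P = ENNReal.ofReal
      (∫ ω, potential μ σ (stoppedValue (driftedPath x₀ μ σ W) ρ ω) ∂P - potential μ σ x₀) := by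
  set Y := driftedPath x₀ μ σ W with hY
  obtain ⟨K, hK⟩ := (isCompact_Icc (a := a) (b := b)).exists_bound_of_continuousOn
    (continuous_potential μ σ).continuousOn
  obtain ⟨L, hL⟩ := (isCompact_Icc (a := a) (b := b)).exists_bound_of_continuousOn
    (continuous_scale μ σ).continuousOn
  have hmeas {f : ℝ → ℝ} (hf : Continuous f) (n : ℕ) :
      AEStronglyMeasurable (fun ω => f (stoppedProcess Y ρ n ω)) P :=
    (hf.measurable.comp (hW.measurable_stoppedProcess x₀ μ σ hρ n)).aestronglyMeasurable
  have hpb (n : ℕ) : ∀ᵐ ω ∂P, ‖potential μ σ (stoppedProcess Y ρ n ω)‖ ≤ K := by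
    filter_upwards [hb] with ω hω using hK _ (stoppedProcess_mem hω n)
  have hpi (n : ℕ) : Integrable (fun ω => potential μ σ (stoppedProcess Y ρ n ω)) P :=
    Integrable.of_bound (hmeas (continuous_potential μ σ) n) K (hpb n)
  -- Optional stopping of `potential - t` at `min n ρ`. As the potential is bounded by `K` on `[a,
  -- b]`, these means stay bounded in `n`, and monotone convergence makes `ρ` integrable.
  have hmain (n : ℕ) : ∫⁻ ω, min (n : ℝ≥0∞) (ρ ω) ∂P = ENNReal.ofReal
      (∫ ω, potential μ σ (stoppedProcess Y ρ n ω) ∂P - potential μ σ x₀) := by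
    obtain ⟨h1, h2⟩ :=
      (hW.martingale_potential_sub x₀ μ hσ).integrable_integral_stopped
        (fun ω => ((continuous_potential μ σ).comp (hW.continuous_driftedPath x₀ μ σ ω)).sub
          NNReal.continuous_coe) hρ n
    have h3 : (fun ω => ((min ((n : ℝ≥0) : WithTop ℝ≥0) (ρ ω)).untopA : ℝ)) =
        fun ω => potential μ σ (stoppedProcess Y ρ n ω) -
          stoppedProcess (fun t ω => potential μ σ (Y t ω) - t) ρ n ω := by
      ext ω
      simp [stoppedProcess]
    have h4 : Integrable (fun ω => ((min ((n : ℝ≥0) : WithTop ℝ≥0) (ρ ω)).untopA : ℝ)) P := by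
      rw [h3]
      exact (hpi n).sub h1
    have h5 : ∫ ω, ((min ((n : ℝ≥0) : WithTop ℝ≥0) (ρ ω)).untopA : ℝ) ∂P =
        ∫ ω, potential μ σ (stoppedProcess Y ρ n ω) ∂P - potential μ σ x₀ := by
      rw [h3, integral_sub (hpi n) h1, h2]
      simp [hW.driftedPath_zero]
    rw [← h5, ofReal_integral_eq_lintegral_ofReal h4 (ae_of_all _ fun ω => NNReal.coe_nonneg _)]
    refine lintegral_congr fun ω => ?_
    rw [ENNReal.ofReal_coe_nnreal]
    exact (coe_untopA (ne_top_of_le_ne_top WithTop.coe_ne_top (min_le_left _ _))).symm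
  have hρm : Measurable fun ω => (ρ ω : ℝ≥0∞) := by
    exact hρ.measurable'
  have hconv : Tendsto (fun n : ℕ => ∫⁻ ω, min (n : ℝ≥0∞) (ρ ω) ∂P) atTop
      (𝓝 (∫⁻ ω, (ρ ω : ℝ≥0∞) ∂P)) := by
    refine lintegral_tendsto_of_tendsto_of_monotone
      (fun n => (measurable_const.min hρm).aemeasurable) (ae_of_all _ fun ω => ?_)
      (ae_of_all _ fun ω => ?_)
    · intro m n hmn
      exact min_le_min_right _ (by exact_mod_cast hmn)
    · have := ENNReal.tendsto_nat_nhds_top.min (tendsto_const_nhds (x := (ρ ω : ℝ≥0∞)))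
      exact this.mono_right (congrArg 𝓝 (min_eq_right le_top)).le
  have hfin : ∀ᵐ ω ∂P, ρ ω ≠ ⊤ := by
    have hle : ∫⁻ ω, (ρ ω : ℝ≥0∞) ∂P ≤ ENNReal.ofReal (K - potential μ σ x₀) := by
      refine le_of_tendsto' hconv fun n => ?_
      rw [hmain n]
      refine ENNReal.ofReal_le_ofReal (sub_le_sub_right ?_ _)
      calc _ ≤ ∫ _, K ∂P := integral_mono_ae (hpi n) (integrable_const _)
            ((hpb n).mono fun ω h => (le_abs_self _).trans h)
        _ = K := by simp
    filter_upwards [ae_lt_top hρm (hle.trans_lt ENNReal.ofReal_lt_top).ne] with ω hω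
    exact hω.ne
  have hlim {f : ℝ → ℝ} (hf : Continuous f) {B : ℝ} (hB : ∀ x ∈ Set.Icc a b, ‖f x‖ ≤ B) :
      Tendsto (fun n : ℕ => ∫ ω, f (stoppedProcess Y ρ n ω) ∂P) atTop
        (𝓝 (∫ ω, f (stoppedValue Y ρ ω) ∂P)) := by
    refine tendsto_integral_of_dominated_convergence (fun _ => B) (hmeas hf)
      (integrable_const _) (fun n => ?_) ?_
    · filter_upwards [hb] with ω hω using hB _ (stoppedProcess_mem hω n)
    · filter_upwards [hfin] with ω hω
      exact (hf.tendsto _).comp (tendsto_stoppedProcess hω)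
  refine ⟨hfin, ?_, ?_⟩
  · refine tendsto_nhds_unique (hlim (continuous_scale μ σ) hL) ?_
    have h (n : ℕ) := (hW.integral_scale_stoppedProcess x₀ μ hσ hρ n).2
    simp only [← hY] at h
    simp only [h]
    exact tendsto_const_nhds
  · refine tendsto_nhds_unique hconv ?_
    simp only [hmain]
    exact (ENNReal.continuous_ofReal.tendsto _).comp
      ((hlim (continuous_potential μ σ) hK).sub_const _)

end IsContinuousBrownian

end Drifted

/-! ### Exit times -/

section Exit

lemma exists_lt_eq_of_lt {f : ℝ≥0 → ℝ} (hf : Continuous f) {a : ℝ} {t : ℝ≥0} (h0 : a < f 0)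
    (ht : f t < a) : ∃ s < t, f s = a := by
  obtain ⟨s, hs, hsa⟩ := intermediate_value_Icc' (zero_le (a := t)) hf.continuousOn
    ⟨ht.le, h0.le⟩
  refine ⟨s, lt_of_le_of_ne hs.2 ?_, hsa⟩
  rintro rfl
  exact ht.ne hsa

variable {Ω : Type*} {Y : ℝ≥0 → Ω → ℝ} {C : Set ℝ} {ω : Ω} {a : ℝ} {t : ℝ≥0}

/-- A continuous path cannot get below `a` without passing through `a`, which lies in `C`. -/
lemma le_of_le_hittingAfter (hc : Continuous fun t => Y t ω) (ha : a ∈ C) (h0 : a < Y 0 ω)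
    (ht : (t : WithTop ℝ≥0) ≤ hittingAfter Y C 0 ω) : a ≤ Y t ω := by
  by_contra! h
  obtain ⟨s, hs, rfl⟩ := exists_lt_eq_of_lt hc h0 h
  exact (WithTop.coe_lt_coe.2 hs).not_ge (ht.trans (hittingAfter_le_of_mem zero_le ha))

lemma ge_of_le_hittingAfter (hc : Continuous fun t => Y t ω) (ha : a ∈ C) (h0 : Y 0 ω < a)
    (ht : (t : WithTop ℝ≥0) ≤ hittingAfter Y C 0 ω) : Y t ω ≤ a := by
  by_contra! h
  obtain ⟨s, hs, hsa⟩ := exists_lt_eq_of_lt (f := fun t => -Y t ω) hc.neg (neg_lt_neg h0)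
    (neg_lt_neg h)
  obtain rfl := neg_injective hsa
  exact (WithTop.coe_lt_coe.2 hs).not_ge (ht.trans (hittingAfter_le_of_mem zero_le ha))

lemma absorbAtZero_congr {Y' : ℝ≥0 → Ω → ℝ} (h : ∀ s, Y s ω = Y' s ω) (t : ℝ≥0) :
    absorbAtZero Y t ω = absorbAtZero Y' t ω := by
  simp only [absorbAtZero]
  by_cases hex : ∃ s ≤ t, Y s ω ≤ 0
  · rw [if_pos hex, if_pos (by simpa only [h] using hex)]
  · rw [if_neg hex, if_neg (by simpa only [h] using hex), h]

/-- A continuous path starting above `0` enters `(-∞, 0]` exactly at `0`, so freezing it there is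
the same as assigning the value `0`. -/
lemma absorbAtZero_eq_stoppedProcess (hc : ∀ ω, Continuous fun t => Y t ω) (h0 : 0 < Y 0 ω) :
    absorbAtZero Y t ω = stoppedProcess Y (hittingAfter Y (Set.Iic 0) 0) t ω := by
  have hiff := hittingAfter_le_iff_exists hc (isClosed_Iic (a := (0 : ℝ))) ω t
  by_cases h : ∃ s ≤ t, Y s ω ≤ 0
  · have hle := hiff.2 h
    rw [absorbAtZero, if_pos h, stoppedProcess_eq_of_le hle, stoppedValue]
    have hcoe := coe_untopA (ne_top_of_le_ne_top WithTop.coe_ne_top hle)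
    exact le_antisymm (le_of_le_hittingAfter (hc ω) (Set.mem_Iic.2 le_rfl) h0 hcoe.le)
      (mem_of_hittingAfter_eq_coe hc isClosed_Iic hcoe.symm)
  · have hle := (not_le.1 (mt hiff.1 h)).le
    rw [absorbAtZero, if_neg h, stoppedProcess, min_eq_left hle]
    rfl

lemma stoppedValue_absorbAtZero (hc : ∀ ω, Continuous fun t => Y t ω) (h0 : 0 < Y 0 ω)
    {τ : Ω → WithTop ℝ≥0} (hτ : τ ω ≠ ⊤) :
    stoppedValue (absorbAtZero Y) τ ω =
      stoppedValue Y (fun ω => min (τ ω) (hittingAfter Y (Set.Iic 0) 0 ω)) ω := by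
  rw [stoppedValue, absorbAtZero_eq_stoppedProcess hc h0, stoppedProcess, stoppedValue,
    coe_untopA hτ]

end Exit

/-! ### The stopping levels -/

section Level

attribute [instance] Play.mΩ Play.isProbabilityMeasure

variable {x₀ μ σ : ℝ}

/-- The time of absorption at `0`. -/
noncomputable def absorptionTime {Ω : Type*} (Y : ℝ≥0 → Ω → ℝ) : Ω → WithTop ℝ≥0 :=
  hittingAfter Y (Set.Iic 0) 0

namespace IsContinuousBrownian

variable {Ω : Type*} {mΩ : MeasurableSpace Ω} {P : Measure Ω} {ℱ : Filtration ℝ≥0 mΩ}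
  {W : ℝ≥0 → Ω → ℝ}

lemma isStoppingTime_hittingAfter (hW : IsContinuousBrownian ℱ W P) (x₀ μ σ : ℝ) {C : Set ℝ}
    (hC : IsClosed C) : IsStoppingTime ℱ (hittingAfter (driftedPath x₀ μ σ W) C 0) :=
  isStoppingTime_hittingAfter_of_isClosed (hW.measurable_driftedPath x₀ μ σ)
    (hW.continuous_driftedPath x₀ μ σ) hC

lemma driftedPath_nonneg (hW : IsContinuousBrownian ℱ W P) (hx₀ : 0 < x₀) (ω : Ω) (t : ℝ≥0)
    (ht : (t : WithTop ℝ≥0) ≤ absorptionTime (driftedPath x₀ μ σ W) ω) :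
    0 ≤ driftedPath x₀ μ σ W t ω :=
  le_of_le_hittingAfter (hW.continuous_driftedPath x₀ μ σ ω) (Set.mem_Iic.2 le_rfl)
    (by rwa [hW.driftedPath_zero]) ht

lemma level_eq (hW : IsContinuousBrownian ℱ W P) (hx₀ : 0 < x₀) {τ : Ω → WithTop ℝ≥0} {ω : Ω}
    (hτ : τ ω ≠ ⊤) :
    stoppedValue (absorbAtZero (driftedPath x₀ μ σ W)) τ ω =
      stoppedValue (driftedPath x₀ μ σ W)
        (fun ω => min (τ ω) (absorptionTime (driftedPath x₀ μ σ W) ω)) ω :=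
  stoppedValue_absorbAtZero (hW.continuous_driftedPath x₀ μ σ)
    (by rwa [hW.driftedPath_zero]) hτ

end IsContinuousBrownian

/-- The stopping level of a play is that of a Brownian motion with continuous paths. -/
lemma Play.exists_isContinuousBrownian (S : Play.{u}) (hx₀ : 0 < x₀) (μ σ : ℝ) :
    ∃ (ℱ : Filtration ℝ≥0 S.mΩ) (W : ℝ≥0 → S.Ω → ℝ), IsContinuousBrownian ℱ W S.P ∧
      IsStoppingTime ℱ S.τ ∧
      S.level x₀ μ σ =ᵐ[S.P] stoppedValue (driftedPath x₀ μ σ W)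
        (fun ω => min (S.τ ω) (absorptionTime (driftedPath x₀ μ σ W) ω)) := by
  obtain ⟨ℱ, W, hle, hW, hWW⟩ := RankGame.exists_isContinuousBrownian S.ℱ S.isBrownian S.adapted
    S.indep_increments
  refine ⟨ℱ, W, hW, fun t => hle t _ (S.isStoppingTime t), ?_⟩
  filter_upwards [hWW, S.finite] with ω hω hτ
  rw [← hW.level_eq hx₀ hτ, Play.level]
  exact absorbAtZero_congr (fun s => by simp only [driftedPath, hω]) _

variable (S : Play.{u})

lemma Play.aemeasurable_level (hx₀ : 0 < x₀) (μ σ : ℝ) :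
    AEMeasurable (S.level x₀ μ σ) S.P := by
  obtain ⟨ℱ, W, hW, hτ, h⟩ := S.exists_isContinuousBrownian hx₀ μ σ
  exact (hW.measurable_stoppedValue x₀ μ σ
    (hτ.min (hW.isStoppingTime_hittingAfter x₀ μ σ isClosed_Iic))).aemeasurable.congr h.symm

lemma Play.isProbabilityMeasure_law (hx₀ : 0 < x₀) (μ σ : ℝ) :
    IsProbabilityMeasure (S.law x₀ μ σ) :=
  Measure.isProbabilityMeasure_map (S.aemeasurable_level hx₀ μ σ)

lemma Play.ae_nonneg_law (hx₀ : 0 < x₀) (μ σ : ℝ) : ∀ᵐ x ∂S.law x₀ μ σ, 0 ≤ x := by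
  refine (ae_map_iff (S.aemeasurable_level hx₀ μ σ) measurableSet_Ici).2 (ae_of_all _ fun ω => ?_)
  simp only [Play.level, stoppedValue, absorbAtZero]
  split_ifs with h
  · exact le_rfl
  · push Not at h
    exact (h _ le_rfl).le

/-- Besides nonnegativity of the levels, this supermartingale inequality is the only constraint on
feasible laws that the equilibrium analysis uses. -/
lemma Play.integrable_scale_law (hx₀ : 0 < x₀) (μ : ℝ) (hσ : 0 < σ) :
    Integrable (scale μ σ) (S.law x₀ μ σ) ∧
      ∫ x, scale μ σ x ∂S.law x₀ μ σ ≤ scale μ σ x₀ := by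
  obtain ⟨ℱ, W, hW, hτ, h⟩ := S.exists_isContinuousBrownian hx₀ μ σ
  have hle := hW.lintegral_scale_stoppedValue_le x₀ μ hσ
    (hτ.min (hW.isStoppingTime_hittingAfter x₀ μ σ isClosed_Iic))
    (S.finite.mono fun ω hω => ne_top_of_le_ne_top hω (min_le_left _ _))
    (fun ω t ht => hW.driftedPath_nonneg hx₀ ω t (ht.trans (min_le_right _ _)))
  have hle' : ∫⁻ x, ENNReal.ofReal (scale μ σ x) ∂S.law x₀ μ σ ≤
      ENNReal.ofReal (scale μ σ x₀) := by
    refine le_of_eq_of_le ?_ hle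
    rw [Play.law, lintegral_map' (f := fun x => ENNReal.ofReal (scale μ σ x)) (ENNReal.measurable_ofReal.comp
      (continuous_scale μ σ).measurable).aemeasurable (S.aemeasurable_level hx₀ μ σ)]
    refine lintegral_congr_ae ?_
    filter_upwards [h] with ω hω
    rw [hω]
    rfl
  have hmono := (strictMono_scale μ hσ).monotone
  have hnn : ∀ᵐ x ∂S.law x₀ μ σ, 0 ≤ scale μ σ x := by
    filter_upwards [S.ae_nonneg_law hx₀ μ σ] with x hx
    exact (scale_zero μ σ).ge.trans (hmono hx)
  have hm : AEStronglyMeasurable (scale μ σ) (S.law x₀ μ σ) :=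
    (continuous_scale μ σ).aestronglyMeasurable
  have hfi : Integrable (scale μ σ) (S.law x₀ μ σ) := by
    refine ⟨hm, ?_⟩
    rw [hasFiniteIntegral_iff_ofReal hnn]
    exact hle'.trans_lt ENNReal.ofReal_lt_top
  refine ⟨hfi, ?_⟩
  rw [← ofReal_integral_eq_lintegral_ofReal hfi hnn] at hle'
  exact (ENNReal.ofReal_le_ofReal_iff ((scale_zero μ σ).ge.trans (hmono hx₀.le))).1 hle'

/-- If a play stops within a bounded range of levels, never at `0`, and preserves the mean in the
natural scale, then its expected duration is determined by its law. -/
theorem Play.duration_eq (hx₀ : 0 < x₀) (μ : ℝ) (hσ : 0 < σ) {k c : ℝ}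
    (h0 : ∀ᵐ x ∂S.law x₀ μ σ, x ≠ 0) (hk : ∀ᵐ x ∂S.law x₀ μ σ, scale μ σ x ≤ k)
    (hkc : k < scale μ σ c) (hs : ∫ x, scale μ σ x ∂S.law x₀ μ σ = scale μ σ x₀) :
    S.duration =
      ENNReal.ofReal (∫ x, potential μ σ x ∂S.law x₀ μ σ - potential μ σ x₀) := by
  have hlevel := S.aemeasurable_level hx₀ μ σ
  have hprob := S.isProbabilityMeasure_law hx₀ μ σ
  have hsi := (S.integrable_scale_law hx₀ μ hσ).1
  have hx₀c : x₀ < c := by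
    refine (strictMono_scale μ hσ).lt_iff_lt.1 (lt_of_le_of_lt ?_ hkc)
    rw [← hs]
    calc _ ≤ ∫ _, k ∂S.law x₀ μ σ := integral_mono_ae hsi (integrable_const _) hk
      _ = k := by simp
  replace h0 := ae_of_ae_map hlevel h0
  replace hk := ae_of_ae_map hlevel hk
  rw [Play.law, integral_map hlevel (continuous_scale μ σ).aestronglyMeasurable] at hs
  have hsi' : Integrable (fun ω => scale μ σ (S.level x₀ μ σ ω)) S.P :=
    hsi.comp_aemeasurable hlevel
  rw [Play.law, integral_map hlevel (continuous_potential μ σ).aestronglyMeasurable]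
  obtain ⟨ℱ, W, hW, hτ, h⟩ := S.exists_isContinuousBrownian hx₀ μ σ
  set Y := driftedPath x₀ μ σ W with hY
  have hYc : ∀ ω, Continuous fun t => Y t ω := hW.continuous_driftedPath x₀ μ σ
  have hY0 : ∀ ω, Y 0 ω = x₀ := hW.driftedPath_zero x₀ μ σ
  have hC : IsClosed (Set.Iic 0 ∪ Set.Ici c : Set ℝ) := isClosed_Iic.union isClosed_Ici
  set T := hittingAfter Y (Set.Iic 0 ∪ Set.Ici c) 0 with hT
  have hTs : IsStoppingTime ℱ T := hW.isStoppingTime_hittingAfter x₀ μ σ hC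
  have hTabs (ω) : T ω ≤ absorptionTime Y ω :=
    hittingAfter_anti Y 0 Set.subset_union_left ω
  have hmem (ω) (t : ℝ≥0) (ht : (t : WithTop ℝ≥0) ≤ T ω) : Y t ω ∈ Set.Icc 0 c :=
    ⟨le_of_le_hittingAfter (hYc ω) (Or.inl (Set.mem_Iic.2 le_rfl)) (by rwa [hY0]) ht,
      ge_of_le_hittingAfter (hYc ω) (Or.inr (Set.mem_Ici.2 le_rfl)) (by rwa [hY0]) ht⟩
  have hmin : IsStoppingTime ℱ fun ω => min (S.τ ω) (T ω) := hτ.min hTs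
  have hmem' (ω) (t : ℝ≥0) (ht : (t : WithTop ℝ≥0) ≤ min (S.τ ω) (T ω)) : Y t ω ∈ Set.Icc 0 c :=
    hmem ω t (ht.trans (min_le_right _ _))
  -- If `τ` outlasts the exit time `T` from `(0, c)`, the exit is not at `0`, since the final level
  -- would then be `0`. It is at the top, where the scale exceeds `k` and hence that of the final
  -- level.
  have hcmp : ∀ᵐ ω ∂S.P, S.τ ω ≤ T ω ∧ stoppedValue Y (fun ω => min (S.τ ω) (T ω)) ω =
      S.level x₀ μ σ ω ∨ T ω < S.τ ω ∧ scale μ σ (S.level x₀ μ σ ω) <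
        scale μ σ (stoppedValue Y (fun ω => min (S.τ ω) (T ω)) ω) := by
    filter_upwards [S.finite, h, h0, hk] with ω hfin hω h0 hk
    rcases le_or_gt (S.τ ω) (T ω) with hle | hlt
    · left
      rw [hω, stoppedValue, stoppedValue, min_eq_left hle, min_eq_left (hle.trans (hTabs ω))]
      exact ⟨hle, rfl⟩
    · right
      refine ⟨hlt, ?_⟩
      have hTtop : T ω ≠ ⊤ := ne_top_of_lt hlt
      have hTu := coe_untopA hTtop
      have hYT : stoppedValue Y (fun ω => min (S.τ ω) (T ω)) ω = Y (T ω).untopA ω := by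
        rw [stoppedValue, min_eq_right hlt.le]
      rw [hYT]
      rcases mem_of_hittingAfter_eq_coe hYc hC hTu.symm with hneg | hge
      · exfalso
        have habs : absorptionTime Y ω = T ω := by
          refine le_antisymm ?_ (hTabs ω)
          rw [← hTu]
          exact hittingAfter_le_of_mem zero_le hneg
        refine h0 ?_
        rw [hω, stoppedValue, habs, min_eq_right hlt.le]
        exact le_antisymm hneg (hmem ω _ hTu.le).1
      · exact hk.trans_lt (hkc.trans_le ((strictMono_scale μ hσ).monotone hge))
  have hopt := hW.optional_stopping_of_bounded x₀ μ hσ hmin (ae_of_all _ hmem')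
  have hτT : ∀ᵐ ω ∂S.P, S.τ ω ≤ T ω := by
    have hi : Integrable
        (fun ω => scale μ σ (stoppedValue Y (fun ω => min (S.τ ω) (T ω)) ω)) S.P := by
      obtain ⟨L, hL⟩ := (isCompact_Icc (a := 0) (b := c)).exists_bound_of_continuousOn
        (continuous_scale μ σ).continuousOn
      refine Integrable.of_bound ((continuous_scale μ σ).measurable.comp
        (hW.measurable_stoppedValue x₀ μ σ hmin)).aestronglyMeasurable L ?_
      filter_upwards [hopt.1] with ω hω using hL _ (stoppedValue_mem (hmem' ω) hω)
    -- Both terms have mean `scale μ σ x₀`, so outlasting `T`, which costs scale strictly, has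
    -- probability zero.
    have hzero : ∫ ω, (scale μ σ (stoppedValue Y (fun ω => min (S.τ ω) (T ω)) ω) -
        scale μ σ (S.level x₀ μ σ ω)) ∂S.P = 0 := by
      rw [integral_sub hi hsi', hopt.2.1, hs, sub_self]
    rw [integral_eq_zero_iff_of_nonneg_ae (f := fun ω => _ - _) ?_ (hi.sub hsi')] at hzero
    · filter_upwards [hcmp, hzero] with ω h1 h2
      rcases h1 with h1 | h1
      · exact h1.1
      · exact absurd (sub_eq_zero.1 h2) h1.2.ne'
    · filter_upwards [hcmp] with ω h1
      rcases h1 with h1 | h1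
      · simp [h1.2]
      · exact sub_nonneg.2 h1.2.le
  have hfinal := (hW.optional_stopping_of_bounded x₀ μ hσ hτ (a := 0) (b := c)
    (hτT.mono fun ω hω t ht => hmem ω t (ht.trans hω))).2.2
  rw [Play.duration, hfinal]
  congr 2
  refine integral_congr_ae ?_
  filter_upwards [h, hτT] with ω h1 h2
  rw [h1, stoppedValue, stoppedValue, min_eq_left (h2.trans (hTabs ω))]

/-! ### Feasible deviations -/

lemma IsContinuousBrownian.feasible {Ω : Type} {mΩ : MeasurableSpace Ω} {P : Measure Ω}
    [IsProbabilityMeasure P] {ℱ : Filtration ℝ≥0 mΩ} {W : ℝ≥0 → Ω → ℝ}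
    (hW : IsContinuousBrownian ℱ W P) (hx₀ : 0 < x₀) (μ σ : ℝ) {ρ : Ω → WithTop ℝ≥0}
    (hρ : IsStoppingTime ℱ ρ) (hfin : ∀ᵐ ω ∂P, ρ ω ≠ ⊤)
    (habs : ∀ ω, ρ ω ≤ absorptionTime (driftedPath x₀ μ σ W) ω) :
    Feasible x₀ μ σ (P.map (stoppedValue (driftedPath x₀ μ σ W) ρ)) := by
  refine ⟨⟨Ω, mΩ, P, ℱ, W, ρ, inferInstance, hW.isBrownian, hW.adapted, hW.indep_increments, hρ,
    hfin⟩, ?_⟩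
  refine Measure.map_congr ?_
  filter_upwards [hfin] with ω hω
  refine (hW.level_eq hx₀ hω).trans ?_
  rw [stoppedValue, stoppedValue, min_eq_left (habs ω)]

/-- Once there is any feasible law, stopping immediately is feasible. -/
lemma feasible_dirac (hx₀ : 0 < x₀) (μ σ : ℝ) {F : Measure ℝ} (hF : Feasible x₀ μ σ F) :
    Feasible x₀ μ σ (Measure.dirac x₀) := by
  -- The Brownian motion behind the given feasible law is reused for the deviation, so none has to
  -- be constructed.
  obtain ⟨S, -⟩ := hF
  obtain ⟨ℱ, W, hW, -, -⟩ := S.exists_isContinuousBrownian hx₀ μ σ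
  have h := hW.feasible hx₀ μ σ (isStoppingTime_const ℱ 0) (ae_of_all _ fun ω => WithTop.coe_ne_top)
    (fun ω => bot_le)
  convert h
  have : stoppedValue (driftedPath x₀ μ σ W) (fun _ => ((0 : ℝ≥0) : WithTop ℝ≥0)) =
      fun _ => x₀ := by
    ext ω
    exact hW.driftedPath_zero x₀ μ σ ω
  rw [this, Measure.map_const]
  simp

/-- Once there is any feasible law, the exit distributions of intervals are feasible. -/
lemma exists_feasible_exit (hx₀ : 0 < x₀) (μ : ℝ) (hσ : 0 < σ) {F : Measure ℝ}
    (hF : Feasible x₀ μ σ F) {a b : ℝ} (ha : 0 ≤ a) (hax : a < x₀) (hxb : x₀ < b) :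
    ∃ G, Feasible x₀ μ σ G ∧ IsProbabilityMeasure G ∧ (∀ᵐ x ∂G, x = a ∨ x = b) ∧
      ∫ x, scale μ σ x ∂G = scale μ σ x₀ := by
  obtain ⟨S, -⟩ := hF
  obtain ⟨ℱ, W, hW, -, -⟩ := S.exists_isContinuousBrownian hx₀ μ σ
  set Y := driftedPath x₀ μ σ W
  have hYc : ∀ ω, Continuous fun t => Y t ω := hW.continuous_driftedPath x₀ μ σ
  have hY0 : ∀ ω, Y 0 ω = x₀ := hW.driftedPath_zero x₀ μ σ
  have hC : IsClosed (Set.Iic a ∪ Set.Ici b : Set ℝ) := isClosed_Iic.union isClosed_Ici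
  set T := hittingAfter Y (Set.Iic a ∪ Set.Ici b) 0 with hT
  have hTs : IsStoppingTime ℱ T := hW.isStoppingTime_hittingAfter x₀ μ σ hC
  have hmem (ω) (t : ℝ≥0) (ht : (t : WithTop ℝ≥0) ≤ T ω) : Y t ω ∈ Set.Icc a b :=
    ⟨le_of_le_hittingAfter (hYc ω) (Or.inl (Set.mem_Iic.2 le_rfl)) (by rwa [hY0]) ht,
      ge_of_le_hittingAfter (hYc ω) (Or.inr (Set.mem_Ici.2 le_rfl)) (by rwa [hY0]) ht⟩
  obtain ⟨hfin, hs, -⟩ := hW.optional_stopping_of_bounded x₀ μ hσ hTs (ae_of_all _ hmem)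
  have hm : Measurable (stoppedValue Y T) := hW.measurable_stoppedValue x₀ μ σ hTs
  refine ⟨_, hW.feasible hx₀ μ σ hTs hfin fun ω => ?_,
    Measure.isProbabilityMeasure_map hm.aemeasurable, ?_, ?_⟩
  · refine hittingAfter_anti Y 0 (fun x hx => Or.inl ?_) ω
    exact le_trans (Set.mem_Iic.1 hx) ha
  · refine (ae_map_iff hm.aemeasurable ?_).2 ?_
    · exact (measurableSet_singleton a).union (measurableSet_singleton b)
    · filter_upwards [hfin] with ω hω
      have hTu := coe_untopA hω
      have h1 := hmem ω _ hTu.le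
      rcases mem_of_hittingAfter_eq_coe hYc hC hTu.symm with h2 | h2
      · exact Or.inl (le_antisymm h2 h1.1)
      · exact Or.inr (le_antisymm h1.2 h2)
  · rw [integral_map hm.aemeasurable (continuous_scale μ σ).aestronglyMeasurable]
    exact hs

end Level

/-! ### The distribution of the rank, given the quantile -/

section Quantile

/-- The probability that `i` of the other `N` players, whose quantiles are independent and uniform,
are above the quantile `q`. -/
noncomputable def rankWeight (N i : ℕ) (q : ℝ) : ℝ := N.choose i * (1 - q) ^ i * q ^ (N - i)

/-- The expected reward of a player at the quantile `q`. -/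
noncomputable def quantileReward (N : ℕ) (R : ℕ → ℝ) (q : ℝ) : ℝ :=
  ∑ i ∈ Finset.range (N + 1), R (i + 1) * rankWeight N i q

lemma continuous_rankWeight (N i : ℕ) : Continuous (rankWeight N i) := by
  unfold rankWeight
  fun_prop

lemma continuous_quantileReward (N : ℕ) (R : ℕ → ℝ) : Continuous (quantileReward N R) :=
  continuous_finsetSum _ fun i _ => continuous_const.mul (continuous_rankWeight N i)

lemma quantileReward_zero (N : ℕ) (R : ℕ → ℝ) : quantileReward N R 0 = R (N + 1) := by
  rw [quantileReward, Finset.sum_range_succ, Finset.sum_eq_zero]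
  · simp [rankWeight]
  · intro i hi
    have : N - i ≠ 0 := (Nat.sub_pos_of_lt (Finset.mem_range.1 hi)).ne'
    simp [rankWeight, this]

lemma quantileReward_one (N : ℕ) (R : ℕ → ℝ) : quantileReward N R 1 = R 1 := by
  rw [quantileReward, Finset.sum_range_succ', Finset.sum_eq_zero]
  · simp [rankWeight]
  · simp [rankWeight]

/-- The differentiated function is the Bernstein polynomial `rankWeight (N + 1) (i + 1)`. For `i <
N` it vanishes at both ends of `[0, 1]`, so neighbouring rank weights have equal integrals. For `i =
N` the weight at `i + 1` is zero. -/
lemma hasDerivAt_rankTail (N i : ℕ) (hi : i ≤ N) (q : ℝ) :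
    HasDerivAt (fun q : ℝ => ((N + 1).choose (i + 1) : ℝ) * (1 - q) ^ (i + 1) * q ^ (N - i))
      ((N + 1) * (rankWeight N (i + 1) q - rankWeight N i q)) q := by
  have h1 : HasDerivAt (fun q : ℝ => (1 - q) ^ (i + 1)) (((i + 1 : ℕ) : ℝ) * (1 - q) ^ i * (-1)) q := by
    simpa using ((hasDerivAt_id q).const_sub 1).fun_pow (i + 1)
  have h2 : HasDerivAt (fun q : ℝ => q ^ (N - i)) (((N - i : ℕ) : ℝ) * q ^ (N - i - 1)) q := by
    simpa using (hasDerivAt_id q).fun_pow (N - i)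
  refine ((h1.const_mul ((N + 1).choose (i + 1) : ℝ)).fun_mul h2).congr_deriv ?_
  have e1 : ((N + 1).choose (i + 1) : ℝ) * (i + 1) = (N + 1) * N.choose i := by
    exact_mod_cast (Nat.add_one_mul_choose_eq N i).symm
  have e2 : ((N + 1).choose (i + 1) : ℝ) * (N - i : ℕ) = (N + 1) * N.choose (i + 1) := by
    have h3 := Nat.choose_mul_succ_eq N (i + 1)
    rw [Nat.succ_sub_succ] at h3
    have h4 : ((N.choose (i + 1) * (N + 1) : ℕ) : ℝ) = ((N + 1).choose (i + 1) * (N - i) : ℕ) := by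
      exact_mod_cast h3
    push_cast [hi] at h4 ⊢
    linarith
  simp only [rankWeight, Nat.sub_sub]
  push_cast
  linear_combination (-(1 - q) ^ i * q ^ (N - i)) * e1 +
    (1 - q) ^ (i + 1) * q ^ (N - (i + 1)) * e2

lemma integral_rankWeight_sub {N i : ℕ} (hi : i < N) :
    ∫ q in (0 : ℝ)..1, (rankWeight N i q - rankWeight N (i + 1) q) = 0 := by
  have h := intervalIntegral.integral_eq_sub_of_hasDerivAt (a := 0) (b := 1)
    (fun q _ => hasDerivAt_rankTail N i hi.le q)
    ((continuous_const.mul ((continuous_rankWeight N (i + 1)).sub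
      (continuous_rankWeight N i))).intervalIntegrable 0 1)
  have h0 : N - i ≠ 0 := (Nat.sub_pos_of_lt hi).ne'
  rw [intervalIntegral.integral_const_mul] at h
  simp only [sub_self, ne_eq, Nat.add_eq_zero_iff, one_ne_zero, and_false, not_false_eq_true,
    zero_pow, mul_zero, zero_mul, h0, mul_eq_zero] at h
  have hN : (N : ℝ) + 1 ≠ 0 := by positivity
  rw [← neg_eq_zero, ← intervalIntegral.integral_neg]
  simpa using h.resolve_left hN

/-- By symmetry all `N + 1` ranks are equally likely; formally the integral is computed for `i = N`
and passed down. -/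
lemma integral_rankWeight {N i : ℕ} (hi : i ≤ N) :
    ∫ q in (0 : ℝ)..1, rankWeight N i q = 1 / (N + 1) := by
  refine Nat.decreasingInduction
    (motive := fun i _ => ∫ q in (0 : ℝ)..1, rankWeight N i q = 1 / (N + 1))
    (fun k hk ih => ?_) ?_ hi
  · have h := integral_rankWeight_sub hk
    rw [intervalIntegral.integral_sub ((continuous_rankWeight N _).intervalIntegrable 0 1)
      ((continuous_rankWeight N _).intervalIntegrable 0 1), ih] at h
    linarith
  · have h := intervalIntegral.integral_eq_sub_of_hasDerivAt (a := 0) (b := 1)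
      (fun q _ => hasDerivAt_rankTail N N le_rfl q)
      ((continuous_const.mul ((continuous_rankWeight N (N + 1)).sub
        (continuous_rankWeight N N))).intervalIntegrable 0 1)
    have hN : (N : ℝ) + 1 ≠ 0 := by positivity
    rw [intervalIntegral.integral_const_mul] at h
    have h1 : ∀ q, rankWeight N (N + 1) q = 0 := by simp [rankWeight]
    simp only [h1, zero_sub, intervalIntegral.integral_neg, Nat.choose_self, Nat.sub_self,
      pow_zero, sub_self, sub_zero, one_pow] at h
    field_simp
    simp at h
    linarith

lemma integral_quantileReward (N : ℕ) (R : ℕ → ℝ) :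
    ∫ q in (0 : ℝ)..1, quantileReward N R q =
      (∑ k ∈ Finset.Icc 1 (N + 1), R k) / (N + 1) := by
  simp only [quantileReward]
  rw [intervalIntegral.integral_finsetSum (f := fun i q => R (i + 1) * rankWeight N i q)
    fun i _ => (continuous_const.mul (continuous_rankWeight N i)).intervalIntegrable 0 1]
  have : ∀ i ∈ Finset.range (N + 1), ∫ q in (0 : ℝ)..1, R (i + 1) * rankWeight N i q =
      R (i + 1) * (1 / (N + 1)) := fun i hi => by
    rw [intervalIntegral.integral_const_mul, integral_rankWeight
      (Nat.lt_succ_iff.1 (Finset.mem_range.1 hi))]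
  rw [Finset.sum_congr rfl this, ← Finset.sum_mul, mul_one_div, Finset.range_eq_Ico,
    Finset.sum_Ico_add' (fun k => R k) 0 (N + 1) 1]
  rfl

/-- Better ranks are more likely at higher quantiles. -/
lemma integral_mul_rankWeight_sub_nonneg {N i : ℕ} (hi : i < N) {h : ℝ → ℝ}
    (hm : MonotoneOn h (Set.Icc 0 1)) (hc : ContinuousOn h (Set.Icc 0 1)) :
    0 ≤ ∫ q in (0 : ℝ)..1, h q * (rankWeight N i q - rankWeight N (i + 1) q) := by
  set d : ℝ → ℝ := fun q => rankWeight N i q - rankWeight N (i + 1) q with hd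
  have hdc : Continuous d := (continuous_rankWeight N i).sub (continuous_rankWeight N (i + 1))
  set a : ℝ := (N.choose i : ℝ)
  set b : ℝ := (N.choose (i + 1) : ℝ)
  have ha : 0 < a := Nat.cast_pos.2 (Nat.choose_pos hi.le)
  have hb : 0 ≤ b := Nat.cast_nonneg _
  -- The interior quantile at which the two weights agree: `d` is nonpositive below `p` and
  -- nonnegative above. Replacing `h q` by `h p` therefore only decreases `h q * d q`, and `d`
  -- integrates to zero.
  set p : ℝ := b / (a + b) with hp
  have hp01 : p ∈ Set.Icc (0 : ℝ) 1 :=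
    ⟨by positivity, (div_le_one (by positivity)).2 (by linarith)⟩
  have hdq (q : ℝ) : d q = (1 - q) ^ i * q ^ (N - (i + 1)) * ((a + b) * (q - p)) := by
    have h1 : N - i = N - (i + 1) + 1 := by omega
    have h2 : (a + b) * p = b := by rw [hp]; field_simp
    simp only [hd, rankWeight]
    rw [h1, mul_sub, h2]
    ring
  have hint (f : ℝ → ℝ) (hf : ContinuousOn f (Set.Icc 0 1)) :
      IntervalIntegrable f volume 0 1 :=
    ContinuousOn.intervalIntegrable (by rwa [Set.uIcc_of_le zero_le_one])
  have hzero : ∫ q in (0 : ℝ)..1, h p * d q = 0 := by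
    rw [intervalIntegral.integral_const_mul, integral_rankWeight_sub hi, mul_zero]
  refine hzero.ge.trans ?_
  refine intervalIntegral.integral_mono_on zero_le_one
    (hint (fun q => h p * d q) (continuousOn_const.mul hdc.continuousOn))
    (hint (fun q => h q * d q) (hc.mul hdc.continuousOn))
    fun q hq => ?_
  change h p * d q ≤ h q * d q
  rw [hdq]
  have hw : 0 ≤ (1 - q) ^ i * q ^ (N - (i + 1)) :=
    mul_nonneg (pow_nonneg (by linarith [hq.2]) _) (pow_nonneg hq.1 _)
  have hkey : 0 ≤ (h q - h p) * ((a + b) * (q - p)) := by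
    rcases le_total q p with hqp | hqp
    · exact mul_nonneg_of_nonpos_of_nonpos (sub_nonpos.2 (hm hq hp01 hqp))
        (mul_nonpos_of_nonneg_of_nonpos (by positivity) (sub_nonpos.2 hqp))
    · exact mul_nonneg (sub_nonneg.2 (hm hp01 hq hqp))
        (mul_nonneg (by positivity) (sub_nonneg.2 hqp))
  linear_combination mul_nonneg hw hkey

/-- A more unequal scheme rewards higher quantiles more. -/
lemma integral_mul_quantileReward_sub_nonneg {N : ℕ} {R R' : ℕ → ℝ} (hL : LorenzLE (N + 1) R' R)
    {h : ℝ → ℝ} (hm : MonotoneOn h (Set.Icc 0 1)) (hc : ContinuousOn h (Set.Icc 0 1)) :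
    0 ≤ ∫ q in (0 : ℝ)..1, h q * (quantileReward N R q - quantileReward N R' q) := by
  set Δ : ℕ → ℝ := fun j => ∑ i ∈ Finset.range j, (R (i + 1) - R' (i + 1)) with hΔ
  have hΔeq (j : ℕ) : Δ j = ∑ k ∈ Finset.Icc 1 j, R k - ∑ k ∈ Finset.Icc 1 j, R' k := by
    rw [← Finset.sum_sub_distrib, hΔ]
    simp only
    rw [Finset.range_eq_Ico, Finset.sum_Ico_add' (fun k => R k - R' k) 0 j 1]
    rfl
  have hΔ0 : Δ (N + 1) = 0 := by rw [hΔeq, hL.1, sub_self]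
  have hΔn (j : ℕ) (hj : j < N) : 0 ≤ Δ (j + 1) := by
    rw [hΔeq, sub_nonneg]
    exact hL.2 _ (Finset.mem_Icc.2 ⟨by omega, by omega⟩)
  -- Abel summation brings in the partial sums `Δ`, which are what the Lorenz order controls; equal
  -- totals remove the boundary term.
  have habel (q : ℝ) : quantileReward N R q - quantileReward N R' q =
      ∑ i ∈ Finset.range N, Δ (i + 1) * (rankWeight N i q - rankWeight N (i + 1) q) := by
    have h1 := Finset.sum_range_by_parts (fun i => rankWeight N i q)
      (fun i => R (i + 1) - R' (i + 1)) (N + 1)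
    simp only [smul_eq_mul, Nat.add_sub_cancel] at h1
    change _ = _ * Δ (N + 1) - ∑ i ∈ Finset.range N, _ * Δ (i + 1) at h1
    rw [hΔ0, mul_zero, zero_sub, ← Finset.sum_neg_distrib] at h1
    rw [quantileReward, quantileReward, ← Finset.sum_sub_distrib]
    calc _ = ∑ i ∈ Finset.range (N + 1), rankWeight N i q * (R (i + 1) - R' (i + 1)) :=
          Finset.sum_congr rfl fun i _ => by ring
      _ = _ := h1
      _ = _ := Finset.sum_congr rfl fun i _ => by ring
  have hrw : (fun q => h q * (quantileReward N R q - quantileReward N R' q)) = fun q =>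
      ∑ i ∈ Finset.range N, Δ (i + 1) * (h q * (rankWeight N i q - rankWeight N (i + 1) q)) := by
    ext q
    rw [habel, Finset.mul_sum]
    exact Finset.sum_congr rfl fun i _ => by ring
  rw [hrw, intervalIntegral.integral_finsetSum]
  · refine Finset.sum_nonneg fun i hi => ?_
    rw [intervalIntegral.integral_const_mul]
    exact mul_nonneg (hΔn i (Finset.mem_range.1 hi))
      (integral_mul_rankWeight_sub_nonneg (Finset.mem_range.1 hi) hm hc)
  · intro i _
    refine ContinuousOn.intervalIntegrable ?_
    rw [Set.uIcc_of_le zero_le_one]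
    exact continuousOn_const.mul (hc.mul ((continuous_rankWeight N i).sub
      (continuous_rankWeight N (i + 1))).continuousOn)

/-- A convex function `G` with subgradient `D` has a larger mean along the rewards of the more
unequal scheme. -/
theorem integral_comp_quantileReward_le {N : ℕ} {R R' : ℕ → ℝ} (hL : LorenzLE (N + 1) R' R)
    {G D : ℝ → ℝ} {c K : ℝ} (hc : 0 ≤ c)
    (hG : ContinuousOn G (Set.Icc 0 K)) (hD : ContinuousOn D (Set.Icc 0 K))
    (htan : ∀ y ∈ Set.Icc 0 K, ∀ z ∈ Set.Icc 0 K, G z + D z * (y - z) ≤ G y)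
    (hR : ∀ q ∈ Set.Icc (0 : ℝ) 1, c * quantileReward N R q ∈ Set.Icc 0 K)
    (hR' : ∀ q ∈ Set.Icc (0 : ℝ) 1, c * quantileReward N R' q ∈ Set.Icc 0 K)
    (hm' : MonotoneOn (quantileReward N R') (Set.Icc 0 1)) :
    ∫ q in (0 : ℝ)..1, G (c * quantileReward N R' q) ≤
      ∫ q in (0 : ℝ)..1, G (c * quantileReward N R q) := by
  have hDm : MonotoneOn D (Set.Icc 0 K) := fun y hy z hz hyz => by
    rcases hyz.eq_or_lt with rfl | hlt
    · exact le_rfl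
    · have h1 := htan y hy z hz
      have h2 := htan z hz y hy
      nlinarith
  have hint (f : ℝ → ℝ) (hf : ContinuousOn f (Set.Icc 0 1)) :
      IntervalIntegrable f volume 0 1 :=
    ContinuousOn.intervalIntegrable (by rwa [Set.uIcc_of_le zero_le_one])
  have hq (R : ℕ → ℝ) : ContinuousOn (fun q => c * quantileReward N R q) (Set.Icc 0 1) :=
    (continuous_const.mul (continuous_quantileReward N R)).continuousOn
  have hG1 := hG.comp (hq R) hR
  have hG2 := hG.comp (hq R') hR'
  -- The tangents are taken along the less unequal scheme. Their slopes increase with the quantile,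
  -- so the linear term has a nonnegative integral.
  set h : ℝ → ℝ := fun q => D (c * quantileReward N R' q) with hh
  have hhc : ContinuousOn h (Set.Icc 0 1) := hD.comp (hq R') hR'
  have hhm : MonotoneOn h (Set.Icc 0 1) := fun x hx y hy hxy =>
    hDm (hR' x hx) (hR' y hy) (mul_le_mul_of_nonneg_left (hm' hx hy hxy) hc)
  have h0 := integral_mul_quantileReward_sub_nonneg hL hhm hhc
  have hlin : ContinuousOn
      (fun q => c * (h q * (quantileReward N R q - quantileReward N R' q))) (Set.Icc 0 1) :=
    continuousOn_const.mul (hhc.mul ((continuous_quantileReward N R).sub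
      (continuous_quantileReward N R')).continuousOn)
  calc _ ≤ (∫ q in (0 : ℝ)..1, G (c * quantileReward N R' q)) +
        ∫ q in (0 : ℝ)..1, c * (h q * (quantileReward N R q - quantileReward N R' q)) := by
        rw [intervalIntegral.integral_const_mul]
        exact le_add_of_nonneg_right (mul_nonneg hc h0)
    _ = ∫ q in (0 : ℝ)..1, (G (c * quantileReward N R' q) +
          c * (h q * (quantileReward N R q - quantileReward N R' q))) :=
        (intervalIntegral.integral_add (hint _ hG2) (hint _ hlin)).symm
    _ ≤ _ := by
        refine intervalIntegral.integral_mono_on zero_le_one (hint _ (hG2.add hlin))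
          (hint _ hG1) fun q hq => ?_
        have := htan _ (hR q hq) _ (hR' q hq)
        simp only [hh]
        linarith

end Quantile

/-! ### The payoff as a function of the stopping level -/

section Payoff

variable {n : ℕ} {R : ℕ → ℝ}

namespace IsNormalizedScheme

lemma nonneg (hR : IsNormalizedScheme n R) {k : ℕ} (hk : k ∈ Set.Icc 1 n) : 0 ≤ R k := by
  rw [← hR.last_eq_zero]
  exact hR.antitone hk ⟨hk.1.trans hk.2, le_rfl⟩ hk.2

lemma le_first (hR : IsNormalizedScheme n R) {k : ℕ} (hk : k ∈ Set.Icc 1 n) : R k ≤ R 1 :=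
  hR.antitone ⟨le_rfl, hk.1.trans hk.2⟩ hk hk.1

/-- The `k` best ranks receive at least `k / (n - 1)` in total. -/
lemma le_sum (hR : IsNormalizedScheme n R) {k : ℕ} (hk1 : 1 ≤ k) (hk : k < n) :
    k / ((n : ℝ) - 1) ≤ ∑ i ∈ Finset.Icc 1 k, R i := by
  obtain ⟨N, rfl⟩ : ∃ N, n = N + 1 := ⟨n - 1, by omega⟩
  have hkN : k ≤ N := Nat.lt_succ_iff.1 hk
  have hN : (0 : ℝ) < N := by exact_mod_cast hk1.trans hkN
  have htot : ∑ i ∈ Finset.Icc 1 N, R i = 1 := by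
    have := hR.total_eq_one
    rwa [Finset.sum_Icc_succ_top (by omega), hR.last_eq_zero, add_zero] at this
  -- `R k` bounds the first `k` rewards from below and the next `N - k` from above; weighting by `N
  -- - k` and `k` eliminates it.
  have h1 : (k : ℝ) * R k ≤ ∑ i ∈ Finset.Icc 1 k, R i := by
    have := Finset.card_nsmul_le_sum (Finset.Icc 1 k) R (R k) fun i hi => by
      have := Finset.mem_Icc.1 hi
      exact hR.antitone ⟨this.1, by omega⟩ ⟨hk1, by omega⟩ this.2
    simpa using this
  have h2 : ∑ i ∈ Finset.Icc (k + 1) N, R i ≤ ((N : ℝ) - k) * R k := by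
    have := Finset.sum_le_card_nsmul (Finset.Icc (k + 1) N) R (R k) fun i hi => by
      have := Finset.mem_Icc.1 hi
      exact hR.antitone ⟨hk1, by omega⟩ ⟨by omega, by omega⟩ (by omega)
    have hcast : ((N - k : ℕ) : ℝ) = N - k := by push_cast [hkN]; ring
    simpa [hcast] using this
  have h3 : ∑ i ∈ Finset.Icc 1 k, R i + ∑ i ∈ Finset.Icc (k + 1) N, R i = 1 := by
    rw [← htot]
    exact Finset.sum_Ico_consecutive R (m := 1) (n := k + 1) (k := N + 1) (by omega) (by omega)
  push_cast
  rw [add_sub_cancel_right, div_le_iff₀ hN]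
  have hkR : (0 : ℝ) < k := by exact_mod_cast hk1
  have hNk : (0 : ℝ) ≤ (N : ℝ) - k := sub_nonneg.2 (by exact_mod_cast hkN)
  nlinarith [mul_le_mul_of_nonneg_left h1 hNk, mul_le_mul_of_nonneg_left h2 hkR.le]

/-- The last rank gets nothing, so the first gets at least `1 / (n - 1)`. Strictness makes sole
first place better than a tie of all players, and makes the logarithm in the critical drift
meaningful. -/
lemma one_div_lt_first (hR : IsNormalizedScheme n R) (hn : 2 ≤ n) : 1 / (n : ℝ) < R 1 := by
  have h := hR.le_sum (k := 1) le_rfl (by omega)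
  have hn' : (2 : ℝ) ≤ n := by exact_mod_cast hn
  simp only [Nat.cast_one, Finset.Icc_self, Finset.sum_singleton] at h
  refine lt_of_lt_of_le ?_ h
  exact one_div_lt_one_div_of_lt (by linarith) (by linarith)

/-- The average reward of consecutive ranks lies between the extreme ones. -/
lemma average_mem (hR : IsNormalizedScheme n R) {i k : ℕ} (h : i + k + 1 ≤ n) :
    (∑ r ∈ Finset.Icc (i + 1) (i + k + 1), R r) / ((k : ℝ) + 1) ∈
      Set.Icc (R (i + k + 1)) (R (i + 1)) := by
  have hk : (0 : ℝ) < k + 1 := by positivity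
  have hcard : (Finset.Icc (i + 1) (i + k + 1)).card = k + 1 := by
    rw [Nat.card_Icc]
    omega
  constructor
  · rw [le_div_iff₀ hk]
    have := Finset.card_nsmul_le_sum (Finset.Icc (i + 1) (i + k + 1)) R (R (i + k + 1))
      fun j hj => by
        have := Finset.mem_Icc.1 hj
        exact hR.antitone ⟨by omega, by omega⟩ ⟨by omega, by omega⟩ this.2
    rw [hcard] at this
    simpa [mul_comm] using this
  · rw [div_le_iff₀ hk]
    have := Finset.sum_le_card_nsmul (Finset.Icc (i + 1) (i + k + 1)) R (R (i + 1))
      fun j hj => by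
        have := Finset.mem_Icc.1 hj
        exact hR.antitone ⟨by omega, by omega⟩ ⟨by omega, by omega⟩ this.1
    rw [hcard] at this
    simpa [mul_comm] using this

end IsNormalizedScheme

open Classical in
/-- The number of others above the level `x`. -/
noncomputable def numAbove (x : ℝ) (y : Fin (n - 1) → ℝ) : ℕ :=
  (Finset.univ.filter fun j => x < y j).card

open Classical in
/-- The number of others at the level `x`. -/
noncomputable def numAt (x : ℝ) (y : Fin (n - 1) → ℝ) : ℕ :=
  (Finset.univ.filter fun j => y j = x).card

lemma rankReward_eq (R : ℕ → ℝ) (x : ℝ) (y : Fin (n - 1) → ℝ) :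
    rankReward R x y = (∑ r ∈ Finset.Icc (numAbove x y + 1) (numAbove x y + numAt x y + 1), R r) /
      ((numAt x y : ℝ) + 1) := rfl

lemma numAbove_add_numAt (x : ℝ) (y : Fin (n - 1) → ℝ) :
    numAbove x y + numAt x y = (Finset.univ.filter fun j => x ≤ y j).card := by
  classical
  rw [numAbove, numAt, ← Finset.card_union_of_disjoint]
  · congr 1
    ext j
    simp [le_iff_lt_or_eq, eq_comm]
  · rw [Finset.disjoint_filter]
    intro j _ h h'
    exact h.ne' h'

lemma numAbove_add_numAt_lt (hn : 2 ≤ n) (x : ℝ) (y : Fin (n - 1) → ℝ) :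
    numAbove x y + numAt x y + 1 ≤ n := by
  rw [numAbove_add_numAt]
  have := Finset.card_filter_le (Finset.univ : Finset (Fin (n - 1))) fun j => x ≤ y j
  rw [Finset.card_univ, Fintype.card_fin] at this
  omega

lemma measurable_rankReward (R : ℕ → ℝ) (x : ℝ) :
    Measurable (rankReward (n := n) R x) := by
  classical
  have h1 : Measurable (numAbove (n := n) x) := by
    unfold numAbove
    simp_rw [Finset.card_filter]
    exact Finset.measurable_fun_sum _ fun j _ =>
      Measurable.ite (measurableSet_lt measurable_const (measurable_pi_apply j))
        measurable_const measurable_const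
  have h2 : Measurable (numAt (n := n) x) := by
    unfold numAt
    simp_rw [Finset.card_filter]
    exact Finset.measurable_fun_sum _ fun j _ =>
      Measurable.ite (measurableSet_eq_fun (measurable_pi_apply j) measurable_const)
        measurable_const measurable_const
  have h3 : Measurable fun p : ℕ × ℕ =>
      (∑ r ∈ Finset.Icc (p.1 + 1) (p.1 + p.2 + 1), R r) / ((p.2 : ℝ) + 1) :=
    measurable_of_countable _
  have h4 : rankReward (n := n) R x = (fun p : ℕ × ℕ =>
      (∑ r ∈ Finset.Icc (p.1 + 1) (p.1 + p.2 + 1), R r) / ((p.2 : ℝ) + 1)) ∘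
        fun y => (numAbove x y, numAt x y) := funext fun y => rankReward_eq R x y
  rw [h4]
  exact h3.comp (h1.prodMk h2)

lemma rankReward_mem (hn : 2 ≤ n) (hR : IsNormalizedScheme n R) (x : ℝ)
    (y : Fin (n - 1) → ℝ) : rankReward R x y ∈ Set.Icc 0 (R 1) := by
  have h := hR.average_mem (numAbove_add_numAt_lt hn x y)
  rw [rankReward_eq]
  have hlt := numAbove_add_numAt_lt hn x y
  exact ⟨(hR.nonneg ⟨by omega, hlt⟩).trans h.1, h.2.trans (hR.le_first ⟨by omega, by omega⟩)⟩

/-- Everyone at or above `x'` is strictly above `x`, so the worst rank in a tie at `x'` is no worse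
than the best rank in a tie at `x`. -/
lemma rankReward_mono (hn : 2 ≤ n) (hR : IsNormalizedScheme n R) {x x' : ℝ} (hx : x < x')
    (y : Fin (n - 1) → ℝ) : rankReward R x y ≤ rankReward R x' y := by
  have h := hR.average_mem (numAbove_add_numAt_lt hn x y)
  have h' := hR.average_mem (numAbove_add_numAt_lt hn x' y)
  have hlt := numAbove_add_numAt_lt hn x y
  have hlt' := numAbove_add_numAt_lt hn x' y
  have hle : numAbove x' y + numAt x' y ≤ numAbove x y := by
    classical
    rw [numAbove_add_numAt, numAbove]
    refine (Finset.card_le_card fun j hj => ?_).trans_eq (by congr)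
    rw [Finset.mem_filter] at hj ⊢
    exact ⟨hj.1, hx.trans_le hj.2⟩
  exact h.2.trans ((hR.antitone ⟨by omega, by omega⟩ ⟨by omega, by omega⟩ (by omega)).trans h'.1)

variable {F : Measure ℝ} [IsProbabilityMeasure F]

lemma integrable_rankReward (hn : 2 ≤ n) (hR : IsNormalizedScheme n R) (x : ℝ) :
    Integrable (fun y => rankReward R x y) (Measure.pi fun _ : Fin (n - 1) => F) := by
  refine Integrable.of_bound (measurable_rankReward R x).aestronglyMeasurable (R 1)
    (ae_of_all _ fun y => ?_)
  have := rankReward_mem hn hR x y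
  rw [Real.norm_eq_abs, abs_of_nonneg this.1]
  exact this.2

lemma expectedPayoff_mem (hn : 2 ≤ n) (hR : IsNormalizedScheme n R) (x : ℝ) :
    expectedPayoff n R F x ∈ Set.Icc 0 (R 1) := by
  refine ⟨integral_nonneg fun y => (rankReward_mem hn hR x y).1, ?_⟩
  calc expectedPayoff n R F x ≤ ∫ _, R 1 ∂(Measure.pi fun _ : Fin (n - 1) => F) :=
        integral_mono (integrable_rankReward hn hR x) (integrable_const _)
          fun y => (rankReward_mem hn hR x y).2
    _ = R 1 := by simp

lemma monotone_expectedPayoff (hn : 2 ≤ n) (hR : IsNormalizedScheme n R) :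
    Monotone (expectedPayoff n R F) := by
  intro x x' hx
  rcases hx.eq_or_lt with rfl | hx
  · exact le_rfl
  · exact integral_mono (integrable_rankReward hn hR x) (integrable_rankReward hn hR x')
      fun y => rankReward_mono hn hR hx y

lemma integrable_expectedPayoff (hn : 2 ≤ n) (hR : IsNormalizedScheme n R) (G : Measure ℝ)
    [IsProbabilityMeasure G] : Integrable (expectedPayoff n R F) G := by
  refine Integrable.of_bound (monotone_expectedPayoff hn hR).measurable.aestronglyMeasurable
    (R 1) (ae_of_all _ fun x => ?_)
  have := expectedPayoff_mem (F := F) hn hR x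
  rw [Real.norm_eq_abs, abs_of_nonneg this.1]
  exact this.2

/-- The payoff jumps at the atoms of the law of the others. -/
lemma expectedPayoff_jump (hn : 2 ≤ n) (hR : IsNormalizedScheme n R) {x x' : ℝ} (hx : x < x') :
    expectedPayoff n R F x + F.real {x} ^ (n - 1) * (R 1 - 1 / n) ≤ expectedPayoff n R F x' := by
  classical
  set S : Set (Fin (n - 1) → ℝ) := Set.univ.pi fun _ => {x} with hS
  have hSm : MeasurableSet S := MeasurableSet.univ_pi fun _ => measurableSet_singleton x
  have hSr : (Measure.pi fun _ : Fin (n - 1) => F).real S = F.real {x} ^ (n - 1) := by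
    rw [Measure.real, hS, Measure.pi_pi]
    simp [Measure.real]
  -- When all others sit at `x`, moving up turns the equal share `1 / n` into the first prize.
  have hpt (y : Fin (n - 1) → ℝ) :
      rankReward R x y + S.indicator (fun _ => R 1 - 1 / (n : ℝ)) y ≤ rankReward R x' y := by
    by_cases hy : y ∈ S
    · have hyx (j) : y j = x := hy j trivial
      have hn1 : n - 1 + 1 = n := by omega
      have e1 : numAbove x y = 0 := by simp [numAbove, hyx]
      have e2 : numAt x y = n - 1 := by simp [numAt, hyx]
      have e3 : numAbove x' y = 0 := by simp [numAbove, hyx, hx.le]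
      have e4 : numAt x' y = 0 := by simp [numAt, hyx, hx.ne]
      have hcast : (((n - 1 : ℕ) : ℝ) + 1) = n := by exact_mod_cast hn1
      rw [Set.indicator_of_mem hy, rankReward_eq, rankReward_eq, e1, e2, e3, e4, hcast]
      simp only [zero_add, hn1, hR.total_eq_one]
      simp
    · rw [Set.indicator_of_notMem hy, add_zero]
      exact rankReward_mono hn hR hx y
  have hi : Integrable (S.indicator fun _ => R 1 - 1 / (n : ℝ))
      (Measure.pi fun _ : Fin (n - 1) => F) :=
    (integrable_const _).indicator hSm
  calc _ = ∫ y, (rankReward R x y + S.indicator (fun _ => R 1 - 1 / (n : ℝ)) y)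
        ∂(Measure.pi fun _ : Fin (n - 1) => F) := by
        rw [integral_add (integrable_rankReward hn hR x) hi, integral_indicator_const _ hSm, hSr,
          smul_eq_mul]
        rfl
    _ ≤ _ := integral_mono ((integrable_rankReward hn hR x).add hi)
        (integrable_rankReward hn hR x') hpt

/-- Against an atomless law, the payoff is a function of the quantile. -/
lemma expectedPayoff_eq_quantileReward [NullSingletonClass F] (R : ℕ → ℝ) (x : ℝ) :
    expectedPayoff n R F x = quantileReward (n - 1) R (F.real (Set.Iic x)) := by
  classical
  set P := Measure.pi fun _ : Fin (n - 1) => F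
  -- The event that exactly the players in `A` are above `x`. These events partition the space, and
  -- the reward is constant on each apart from ties, which are null.
  let S (A : Finset (Fin (n - 1))) : Set (Fin (n - 1) → ℝ) :=
    Set.univ.pi fun j => if j ∈ A then Set.Ioi x else Set.Iic x
  have hSm (A) : MeasurableSet (S A) := MeasurableSet.univ_pi fun j => by
    split_ifs
    · exact measurableSet_Ioi
    · exact measurableSet_Iic
  have hq : F.real (Set.Ioi x) = 1 - F.real (Set.Iic x) := by
    rw [← Set.compl_Iic, probReal_compl_eq_one_sub measurableSet_Iic]
  have hSr (A) : P.real (S A) =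
      (1 - F.real (Set.Iic x)) ^ A.card * F.real (Set.Iic x) ^ (n - 1 - A.card) := by
    rw [Measure.real, Measure.pi_pi, ENNReal.toReal_prod, ← hq]
    have : ∀ j, (F (if j ∈ A then Set.Ioi x else Set.Iic x)).toReal =
        if j ∈ A then F.real (Set.Ioi x) else F.real (Set.Iic x) := fun j => by
      split_ifs <;> rfl
    simp_rw [this]
    rw [Finset.prod_ite, Finset.prod_const, Finset.prod_const, Finset.filter_mem_eq_inter,
      Finset.univ_inter]
    congr 2
    rw [Finset.filter_not, Finset.filter_mem_eq_inter, Finset.univ_inter, ← Finset.compl_eq_univ_sdiff,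
      Finset.card_compl, Fintype.card_fin]
  have hmemS (A) (y : Fin (n - 1) → ℝ) :
      y ∈ S A ↔ A = Finset.univ.filter fun j => x < y j := by
    simp only [S, Set.mem_univ_pi, Finset.ext_iff, Finset.mem_filter, Finset.mem_univ, true_and]
    refine forall_congr' fun j => ?_
    by_cases hj : j ∈ A <;> simp [hj]
  have hae : ∀ᵐ y ∂P, rankReward R x y =
      ∑ A ∈ Finset.univ.powerset, (S A).indicator (fun _ => R (A.card + 1)) y := by
    have h0 : ∀ᵐ y ∂P, ∀ j, y j ≠ x := by
      rw [ae_all_iff]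
      intro j
      rw [ae_iff]
      simpa using Measure.pi_hyperplane (fun _ : Fin (n - 1) => F) j x
    filter_upwards [h0] with y hy
    have e : numAt x y = 0 := by simp [numAt, hy]
    rw [Finset.sum_eq_single (Finset.univ.filter fun j => x < y j)]
    · rw [Set.indicator_of_mem ((hmemS _ y).2 rfl), rankReward_eq, e]
      simp only [add_zero, Finset.Icc_self, Finset.sum_singleton, Nat.cast_zero, zero_add, div_one]
      rfl
    · intro A _ hA
      exact Set.indicator_of_notMem (fun h => hA ((hmemS A y).1 h)) _
    · intro h
      exact absurd (Finset.mem_powerset.2 (Finset.subset_univ _)) h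
  rw [expectedPayoff, integral_congr_ae hae, integral_finsetSum]
  · simp_rw [integral_indicator_const _ (hSm _), hSr, smul_eq_mul]
    rw [Finset.sum_powerset_apply_card (fun m => (1 - F.real (Set.Iic x)) ^ m *
      F.real (Set.Iic x) ^ (n - 1 - m) * R (m + 1))]
    rw [quantileReward, Finset.card_univ, Fintype.card_fin]
    refine Finset.sum_congr rfl fun i _ => ?_
    rw [rankWeight, nsmul_eq_mul]
    ring
  · exact fun A _ => (integrable_const _).indicator (hSm A)

end Payoff

/-! ### The probability integral transform -/

section Cdf

variable {F : Measure ℝ} [IsProbabilityMeasure F] [NullSingletonClass F]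

lemma continuous_real_Iic : Continuous fun x => F.real (Set.Iic x) := by
  have h : (fun x => F.real (Set.Iic x)) = cdf F := by
    ext x
    rw [cdf_eq_real]
  rw [h, continuous_iff_continuousAt]
  intro x
  rw [(monotone_cdf F).continuousAt_iff_leftLim_eq_rightLim]
  have h1 : ENNReal.ofReal (cdf F x - Function.leftLim (cdf F) x) = 0 := by
    rw [← StieltjesFunction.measure_singleton, measure_cdf, measure_singleton]
  rw [StieltjesFunction.rightLim_eq]
  refine le_antisymm ((monotone_cdf F).leftLim_le le_rfl) ?_
  linarith [ENNReal.ofReal_eq_zero.1 h1]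

/-- The quantile of a random variable with an atomless law is uniformly distributed. -/
theorem map_real_Iic : F.map (fun x => F.real (Set.Iic x)) = volume.restrict (Set.Icc 0 1) := by
  have hc : Continuous fun x => F.real (Set.Iic x) := continuous_real_Iic
  have hmono : Monotone fun x => F.real (Set.Iic x) := fun x y h =>
    measureReal_mono (Set.Iic_subset_Iic.2 h)
  have : IsProbabilityMeasure (F.map fun x => F.real (Set.Iic x)) :=
    Measure.isProbabilityMeasure_map hc.measurable.aemeasurable
  refine Measure.ext_of_Iic _ _ fun q => ?_
  rw [Measure.map_apply hc.measurable measurableSet_Iic,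
    Measure.restrict_apply measurableSet_Iic]
  rcases lt_or_ge q 0 with hq | hq
  · have e1 : (fun x => F.real (Set.Iic x)) ⁻¹' Set.Iic q = ∅ := by
      ext x
      simpa using hq.trans_le measureReal_nonneg
    have e2 : Set.Iic q ∩ Set.Icc (0 : ℝ) 1 = ∅ := by
      ext x
      simp only [Set.mem_inter_iff, Set.mem_Iic, Set.mem_Icc, Set.mem_empty_iff_false, iff_false]
      intro h
      linarith [h.1, h.2.1]
    rw [e1, e2, measure_empty, measure_empty]
  rcases le_or_gt 1 q with hq1 | hq1
  · have e1 : (fun x => F.real (Set.Iic x)) ⁻¹' Set.Iic q = Set.univ := by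
      ext x
      simpa using measureReal_le_one.trans hq1
    have e2 : Set.Iic q ∩ Set.Icc (0 : ℝ) 1 = Set.Icc 0 1 :=
      Set.inter_eq_right.2 fun x hx => hx.2.trans hq1
    rw [e1, e2, measure_univ, Real.volume_Icc]
    simp
  have e2 : Set.Iic q ∩ Set.Icc (0 : ℝ) 1 = Set.Icc 0 q := by
    ext x
    simp only [Set.mem_inter_iff, Set.mem_Iic, Set.mem_Icc]
    exact ⟨fun h => ⟨h.2.1, h.1⟩, fun h => ⟨h.2, h.1, h.2.trans hq1.le⟩⟩
  rw [e2, Real.volume_Icc, sub_zero]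
  set A := (fun x => F.real (Set.Iic x)) ⁻¹' Set.Iic q with hA
  have hAc : IsClosed A := isClosed_Iic.preimage hc
  have htop : Tendsto (fun x => F.real (Set.Iic x)) atTop (𝓝 1) := 
    (tendsto_cdf_atTop F).congr fun x => cdf_eq_real F x
  have hbot : Tendsto (fun x => F.real (Set.Iic x)) atBot (𝓝 0) := 
    (tendsto_cdf_atBot F).congr fun x => cdf_eq_real F x
  obtain ⟨b, hb⟩ := (htop.eventually_const_lt hq1).exists
  have hbdd : BddAbove A := ⟨b, fun x hx => by
    by_contra! h
    exact absurd ((hmono h.le).trans hx) (not_le.2 hb)⟩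
  rcases A.eq_empty_or_nonempty with hempty | hne
  · rw [hempty, measure_empty]
    have : q ≤ 0 := by
      refine ge_of_tendsto' hbot fun x => ?_
      by_contra! h
      have : x ∈ A := h.le
      rw [hempty] at this
      exact this
    rw [le_antisymm this hq, ENNReal.ofReal_zero]
  -- The distribution function may be flat, so the preimage is described by its largest point;
  -- continuity forces the value `q` there.
  · have hAeq : A = Set.Iic (sSup A) := by
      ext x
      refine ⟨fun hx => le_csSup hbdd hx, fun hx => ?_⟩
      exact (hmono (Set.mem_Iic.1 hx)).trans (hAc.csSup_mem hne hbdd)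
    have hval : F.real (Set.Iic (sSup A)) = q := by
      refine le_antisymm (hAc.csSup_mem hne hbdd) ?_
      have hright : Tendsto (fun x => F.real (Set.Iic x)) (𝓝[>] (sSup A))
          (𝓝 (F.real (Set.Iic (sSup A)))) := (hc.tendsto _).mono_left nhdsWithin_le_nhds
      refine ge_of_tendsto hright ?_
      filter_upwards [self_mem_nhdsWithin] with x hx
      by_contra! h
      exact absurd (le_csSup hbdd (show x ∈ A from h.le)) (not_le.2 hx)
    rw [hAeq, ← hval, ofReal_measureReal]

end Cdf

/-- The expected reward increases with the quantile. -/
lemma monotoneOn_quantileReward {n : ℕ} {R : ℕ → ℝ} (hn : 2 ≤ n)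
    (hR : IsNormalizedScheme n R) : MonotoneOn (quantileReward (n - 1) R) (Set.Icc 0 1) := by
  -- Against opponents uniform on `[0, 1]` the level is its own quantile, so monotonicity is
  -- inherited from the payoff.
  have hprob : IsProbabilityMeasure (volume.restrict (Set.Icc (0 : ℝ) 1)) :=
    ⟨by simp⟩
  have hu {q : ℝ} (hq : q ∈ Set.Icc (0 : ℝ) 1) :
      (volume.restrict (Set.Icc (0 : ℝ) 1)).real (Set.Iic q) = q := by
    have e : Set.Iic q ∩ Set.Icc (0 : ℝ) 1 = Set.Icc 0 q := by
      ext x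
      simp only [Set.mem_inter_iff, Set.mem_Iic, Set.mem_Icc]
      exact ⟨fun h => ⟨h.2.1, h.1⟩, fun h => ⟨h.2, h.1, h.2.trans hq.2⟩⟩
    rw [Measure.real, Measure.restrict_apply measurableSet_Iic, e, Real.volume_Icc, sub_zero,
      ENNReal.toReal_ofReal hq.1]
  intro q hq q' hq' h
  have := monotone_expectedPayoff (F := volume.restrict (Set.Icc (0 : ℝ) 1)) hn hR h
  rwa [expectedPayoff_eq_quantileReward, expectedPayoff_eq_quantileReward, hu hq, hu hq'] at this

/-! ### Equilibrium distributions -/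

section Equilibrium

variable {n : ℕ} {R : ℕ → ℝ} {x₀ μ σ : ℝ} {F : Measure ℝ}

lemma Feasible.isProbabilityMeasure (hx₀ : 0 < x₀) (hF : Feasible x₀ μ σ F) :
    IsProbabilityMeasure F := by
  obtain ⟨S, rfl⟩ := hF
  exact S.isProbabilityMeasure_law hx₀ μ σ

lemma Feasible.ae_nonneg (hx₀ : 0 < x₀) (hF : Feasible x₀ μ σ F) : ∀ᵐ x ∂F, 0 ≤ x := by
  obtain ⟨S, rfl⟩ := hF
  exact S.ae_nonneg_law hx₀ μ σ

lemma Feasible.integrable_scale (hx₀ : 0 < x₀) (hσ : 0 < σ) (hF : Feasible x₀ μ σ F) :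
    Integrable (scale μ σ) F ∧ ∫ x, scale μ σ x ∂F ≤ scale μ σ x₀ := by
  obtain ⟨S, rfl⟩ := hF
  exact S.integrable_scale_law hx₀ μ hσ

/-- In equilibrium, the payoff lies below a line in the natural scale through the equilibrium
value at the starting level. -/
lemma IsEquilibrium.exists_slope (hn : 2 ≤ n) (hR : IsNormalizedScheme n R) (hx₀ : 0 < x₀)
    (hσ : 0 < σ) (hF : IsEquilibrium n R x₀ μ σ F) :
    ∃ β, 0 ≤ β ∧ ∀ x, 0 ≤ x → expectedPayoff n R F x ≤
      ∫ x, expectedPayoff n R F x ∂F + β * (scale μ σ x - scale μ σ x₀) := by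
  have hFp := hF.1.isProbabilityMeasure hx₀
  set u := expectedPayoff n R F with hu
  set V := ∫ x, u x ∂F
  set s := scale μ σ
  have hs : StrictMono s := strictMono_scale μ hσ
  have hum : Monotone u := monotone_expectedPayoff hn hR
  have hx₀V : u x₀ ≤ V := by
    simpa using hF.2 _ (feasible_dirac hx₀ μ σ hF.1)
  -- Exiting `(a, b)` is not profitable. Since the exit law has scale mean `s x₀`, the chord through
  -- the endpoints passes below `V` at `s x₀`, so slopes from `(s x₀, V)` to the right are at most
  -- those to the left.
  have hchord {a b : ℝ} (ha : 0 ≤ a) (hax : a < x₀) (hxb : x₀ < b) :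
      (u b - V) * (s x₀ - s a) ≤ (V - u a) * (s b - s x₀) := by
    obtain ⟨G, hG, hGp, hGab, hGs⟩ := exists_feasible_exit hx₀ μ hσ hF.1 ha hax hxb
    have hsi := (hG.integrable_scale hx₀ hσ).1
    have hab : 0 < s b - s a := sub_pos.2 (hs (hax.trans hxb))
    have h1 : ∫ x, u x ∂G = u a + (u b - u a) / (s b - s a) * (s x₀ - s a) := by
      have : ∀ᵐ x ∂G, u x = u a + (u b - u a) / (s b - s a) * (s x - s a) := by
        filter_upwards [hGab] with x hx
        rcases hx with rfl | rfl
        · simp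
        · field_simp
          ring
      have hsi' : Integrable (fun x => s x - s a) G := hsi.sub (integrable_const _)
      rw [integral_congr_ae this, integral_add (integrable_const _) (hsi'.const_mul _),
        integral_const_mul, integral_sub hsi (integrable_const _), hGs]
      simp [s]
    have h2 : ∫ x, u x ∂G ≤ V := hF.2 G hG
    rw [h1, div_mul_eq_mul_div, ← le_sub_iff_add_le', div_le_iff₀ hab] at h2
    linear_combination h2
  -- The infimum of the left slopes separates them from the right slopes and serves as `β`.
  set Q : Set ℝ := (fun a => (V - u a) / (s x₀ - s a)) '' Set.Ico 0 x₀ with hQ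
  have hQne : Q.Nonempty := ⟨_, 0, ⟨le_rfl, hx₀⟩, rfl⟩
  have hQ0 : ∀ r ∈ Q, 0 ≤ r := by
    rintro _ ⟨a, ha, rfl⟩
    exact div_nonneg (sub_nonneg.2 ((hum ha.2.le).trans hx₀V)) (sub_nonneg.2 (hs ha.2).le)
  refine ⟨sInf Q, le_csInf hQne hQ0, fun x hx => ?_⟩
  rcases lt_trichotomy x x₀ with hlt | rfl | hgt
  · have h1 : sInf Q ≤ (V - u x) / (s x₀ - s x) := csInf_le ⟨0, hQ0⟩ ⟨x, ⟨hx, hlt⟩, rfl⟩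
    rw [le_div_iff₀ (sub_pos.2 (hs hlt))] at h1
    linear_combination h1
  · simpa using hx₀V
  · have h1 : (u x - V) / (s x - s x₀) ≤ sInf Q := by
      refine le_csInf hQne ?_
      rintro _ ⟨a, ha, rfl⟩
      rw [div_le_div_iff₀ (sub_pos.2 (hs hgt)) (sub_pos.2 (hs ha.2))]
      exact hchord ha.1 ha.2 hgt
    rw [div_le_iff₀ (sub_pos.2 (hs hgt))] at h1
    linear_combination h1

/-- In equilibrium the stopping level is atomless, and its natural scale is proportional to the
expected reward at its quantile. -/
theorem IsEquilibrium.structure (hn : 2 ≤ n) (hR : IsNormalizedScheme n R) (hx₀ : 0 < x₀)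
    (hσ : 0 < σ) (hF : IsEquilibrium n R x₀ μ σ F) :
    NullSingletonClass F ∧
    (∀ᵐ x ∂F, scale μ σ x =
      n * scale μ σ x₀ * quantileReward (n - 1) R (F.real (Set.Iic x))) ∧
    ∫ x, scale μ σ x ∂F = scale μ σ x₀ := by
  have hFp := hF.1.isProbabilityMeasure hx₀
  have hF0 := hF.1.ae_nonneg hx₀
  obtain ⟨hsi, hsle⟩ := hF.1.integrable_scale hx₀ hσ
  obtain ⟨β, hβ, hline⟩ := hF.exists_slope hn hR hx₀ hσ
  have hui := integrable_expectedPayoff (F := F) hn hR F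
  have humem := expectedPayoff_mem (F := F) hn hR
  have hjump := fun x x' (h : x < x') => expectedPayoff_jump (F := F) hn hR h
  have hquant := fun (_ : NullSingletonClass F) => expectedPayoff_eq_quantileReward (n := n) (F := F) R
  set u := expectedPayoff n R F with hu
  set V := ∫ x, u x ∂F with hV
  set s := scale μ σ with hs_def
  have hs : StrictMono s := strictMono_scale μ hσ
  have hsc : Continuous s := continuous_scale μ σ
  have hs0 : s 0 = 0 := scale_zero μ σ
  have hsi' : Integrable (fun x => s x - s x₀) F := hsi.sub (integrable_const _)
  have hline_i : Integrable (fun x => V + β * (s x - s x₀)) F :=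
    (integrable_const _).add (hsi'.const_mul _)
  have hint : ∫ x, (V + β * (s x - s x₀) - u x) ∂F = β * (∫ x, s x ∂F - s x₀) := by
    rw [integral_sub hline_i hui, integral_add (integrable_const _) (hsi'.const_mul _),
      integral_const_mul, integral_sub hsi (integrable_const _)]
    simp [hV]
  have hnn : 0 ≤ᵐ[F] fun x => V + β * (s x - s x₀) - u x := by
    filter_upwards [hF0] with x hx using sub_nonneg.2 (hline x hx)
  have hβs : β * (∫ x, s x ∂F - s x₀) = 0 := by
    refine le_antisymm (mul_nonpos_of_nonneg_of_nonpos hβ (sub_nonpos.2 hsle)) ?_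
    rw [← hint]
    exact integral_nonneg_of_ae hnn
  have heq : ∀ᵐ x ∂F, u x = V + β * (s x - s x₀) := by
    have := (integral_eq_zero_iff_of_nonneg_ae hnn (hline_i.sub hui)).1 (hint.trans hβs)
    filter_upwards [this] with x hx using (sub_eq_zero.1 hx).symm
  have hna : NullSingletonClass F := by
    refine ⟨fun x => ?_⟩
    by_contra hx
    -- Almost sure statements hold at an atom itself; in particular `u` touches the line there, and
    -- its jump would carry it above the line just to the right.
    have hmem {p : ℝ → Prop} (hp : ∀ᵐ y ∂F, p y) : p x := by
      by_contra hpx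
      exact hx (measure_mono_null (Set.singleton_subset_iff.2 hpx) (ae_iff.1 hp))
    have hx0 : 0 ≤ x := hmem hF0
    have hux : u x = V + β * (s x - s x₀) := hmem heq
    set δ := F.real {x} ^ (n - 1) * (R 1 - 1 / n) with hδ
    have hδ0 : 0 < δ := by
      have h1 : 0 < F.real {x} := ENNReal.toReal_pos hx (measure_ne_top _ _)
      have h2 := sub_pos.2 (hR.one_div_lt_first hn)
      positivity
    have hlim : Tendsto (fun y => β * (s y - s x)) (𝓝[>] x) (𝓝 (β * (s x - s x))) :=
      ((continuous_const.mul (hsc.sub continuous_const)).tendsto x).mono_left nhdsWithin_le_nhds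
    have hle : δ ≤ β * (s x - s x) := by
      refine ge_of_tendsto hlim ?_
      filter_upwards [self_mem_nhdsWithin] with y hy
      have h1 := hjump x y hy
      have h2 := hline y (hx0.trans (le_of_lt hy))
      linarith
    simp only [sub_self, mul_zero] at hle
    linarith
  have hN : ((n - 1 : ℕ) : ℝ) + 1 = n := by
    have : n - 1 + 1 = n := by omega
    exact_mod_cast this
  have hn1 : n - 1 + 1 = n := by omega
  have hφc := continuous_quantileReward (n - 1) R
  have hFc : Continuous fun x => F.real (Set.Iic x) := continuous_real_Iic
  have hφ0 : quantileReward (n - 1) R 0 = 0 := by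
    rw [quantileReward_zero, hn1, hR.last_eq_zero]
  replace hquant : ∀ x, u x = quantileReward (n - 1) R (F.real (Set.Iic x)) := hquant hna
  have hV1 : V = 1 / n := by
    have h1 : V = ∫ q in (0 : ℝ)..1, quantileReward (n - 1) R q := by
      rw [intervalIntegral.integral_of_le zero_le_one, ← integral_Icc_eq_integral_Ioc,
        ← map_real_Iic (F := F), integral_map hFc.measurable.aemeasurable
          hφc.aestronglyMeasurable]
      exact integral_congr_ae (ae_of_all _ hquant)
    rw [h1, integral_quantileReward, hn1, hR.total_eq_one, hN]
  -- The height of the line at level `0`. It bounds the payoff there, so is nonnegative. If it were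
  -- positive, almost all quantiles would earn at least `a`, whereas rewards tend to `R n = 0` at
  -- low quantiles.
  set a := V - β * s x₀ with ha
  have ha0 : 0 ≤ a := by
    have h1 := hline 0 le_rfl
    have h2 := (humem 0).1
    rw [hs0] at h1
    linarith
  have ha1 : a ≤ 0 := by
    by_contra! hpos
    have hφa : ∀ᵐ q ∂volume.restrict (Set.Icc (0 : ℝ) 1), a ≤ quantileReward (n - 1) R q := by
      rw [← map_real_Iic (F := F)]
      refine (ae_map_iff hFc.measurable.aemeasurable
        (measurableSet_le measurable_const hφc.measurable)).2 ?_
      filter_upwards [heq, hF0] with x hx hx0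
      rw [← hquant x, hx]
      have : 0 ≤ s x := hs0.ge.trans (hs.monotone hx0)
      nlinarith [mul_nonneg hβ this]
    have hev : ∀ᶠ q in 𝓝 (0 : ℝ), quantileReward (n - 1) R q < a :=
      (hφc.tendsto 0).eventually_lt_const (by rwa [hφ0])
    obtain ⟨ε, hε, hball⟩ := Metric.eventually_nhds_iff.1 hev
    rw [ae_iff, Measure.restrict_apply₀' measurableSet_Icc.nullMeasurableSet] at hφa
    have hsub : Set.Ico (0 : ℝ) (min ε 1) ⊆
        {q | ¬ a ≤ quantileReward (n - 1) R q} ∩ Set.Icc 0 1 := fun q hq => by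
      have h1 := lt_min_iff.1 hq.2
      refine ⟨not_le.2 (hball ?_), hq.1, h1.2.le⟩
      rw [Real.dist_eq, sub_zero, abs_of_nonneg hq.1]
      exact h1.1
    have h0 := measure_mono_null hsub hφa
    rw [Real.volume_Ico, ENNReal.ofReal_eq_zero, sub_zero] at h0
    exact absurd h0 (not_le.2 (lt_min hε one_pos))
  have hn0 : (0 : ℝ) < n := by exact_mod_cast (by omega : 0 < n)
  have hβs0 : β * s x₀ = 1 / n := by linarith [le_antisymm ha1 ha0]
  have hβ0 : β ≠ 0 := by
    rintro rfl
    rw [zero_mul] at hβs0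
    have : (0 : ℝ) < 1 / n := by positivity
    linarith
  refine ⟨hna, ?_, sub_eq_zero.1 ((mul_eq_zero.1 hβs).resolve_left hβ0)⟩
  filter_upwards [heq] with x hx
  rw [← hquant x]
  have h1 : u x = β * s x := by rw [hx]; linarith
  have h2 : (n : ℝ) * s x₀ * β = 1 := by
    rw [mul_assoc, mul_comm (s x₀), hβs0]
    field_simp
  rw [h1, ← mul_assoc, h2, one_mul]

end Equilibrium

/-! ### The duration in equilibrium -/

section Duration

variable {n : ℕ} {R R' : ℕ → ℝ} {x₀ μ σ : ℝ}

lemma IsNormalizedScheme.quantileReward_mem (hn : 2 ≤ n) (hR : IsNormalizedScheme n R) {q : ℝ}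
    (hq : q ∈ Set.Icc (0 : ℝ) 1) : quantileReward (n - 1) R q ∈ Set.Icc 0 (R 1) := by
  have hm := monotoneOn_quantileReward hn hR
  have h0 : quantileReward (n - 1) R 0 = 0 := by
    rw [quantileReward_zero, show n - 1 + 1 = n by omega, hR.last_eq_zero]
  have h1 := quantileReward_one (n - 1) R
  exact ⟨h0 ▸ hm ⟨le_rfl, zero_le_one⟩ hq hq.1, h1 ▸ hm hq ⟨zero_le_one, le_rfl⟩ hq.2⟩

lemma IsNormalizedScheme.criticalDrift_eq (hR : IsNormalizedScheme n R) (x₀ σ : ℝ) :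
    criticalDrift n R x₀ σ = σ ^ 2 / (2 * x₀) * Real.log (R 1 / (R 1 - 1 / n)) := by
  rw [criticalDrift, averageReward, hR.total_eq_one, hR.last_eq_zero, sub_zero]

/-- The critical drift decreases with the first prize. -/
lemma criticalDrift_anti (hn : 2 ≤ n) (hR : IsNormalizedScheme n R)
    (hR' : IsNormalizedScheme n R') (hx₀ : 0 < x₀) (h : R' 1 ≤ R 1) :
    criticalDrift n R x₀ σ ≤ criticalDrift n R' x₀ σ := by
  rw [hR.criticalDrift_eq, hR'.criticalDrift_eq]
  have h1 := hR.one_div_lt_first hn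
  have h1' := hR'.one_div_lt_first hn
  have hn0 : (0 : ℝ) < 1 / n := by
    have : (0 : ℝ) < n := by exact_mod_cast (by omega : 0 < n)
    positivity
  refine mul_le_mul_of_nonneg_left (Real.log_le_log (div_pos (by linarith) (by linarith)) ?_)
    (by positivity)
  rw [div_le_div_iff₀ (by linarith) (by linarith)]
  nlinarith

/-- Below the critical drift, the levels that are needed in equilibrium are bounded. -/
lemma exists_lt_scale (hn : 2 ≤ n) (hR : IsNormalizedScheme n R) (hx₀ : 0 < x₀) (hσ : 0 < σ)
    (hμ : μ < criticalDrift n R x₀ σ) : ∃ c, n * scale μ σ x₀ * R 1 < scale μ σ c := by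
  set k := n * scale μ σ x₀ * R 1 with hk
  rcases lt_trichotomy μ 0 with h | h | h
  · refine ⟨k + 1, lt_of_lt_of_le (lt_add_one k) ?_⟩
    rw [scale, if_neg h.ne]
    have hθ : 2 * μ / σ ^ 2 < 0 := div_neg_of_neg_of_pos (by linarith) (by positivity)
    rw [le_div_iff_of_neg hθ]
    have := Real.add_one_le_exp (-(2 * μ / σ ^ 2) * (k + 1))
    linarith
  · exact ⟨k + 1, by simp [scale, h]⟩
  · set θ := 2 * μ / σ ^ 2 with hθ
    have hθ0 : 0 < θ := by positivity
    have hn0 : (0 : ℝ) < n := by exact_mod_cast (by omega : 0 < n)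
    have h1 := hR.one_div_lt_first hn
    have hR1 : 0 < R 1 := lt_trans (by positivity) h1
    -- For `μ > 0` the scale function increases to `1 / θ`; the drift bound places `k` below this
    -- limit.
    have hlt : θ * k < 1 := by
      rw [hR.criticalDrift_eq] at hμ
      have h2 : θ * x₀ < Real.log (R 1 / (R 1 - 1 / n)) := by
        have h3 : θ * x₀ = μ / (σ ^ 2 / (2 * x₀)) := by
          rw [hθ]
          field_simp
        rw [h3, div_lt_iff₀ (by positivity)]
        linarith
      have h4 : Real.exp (θ * x₀) < R 1 / (R 1 - 1 / n) := by
        rwa [← Real.lt_log_iff_exp_lt (div_pos hR1 (sub_pos.2 h1))]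
      have h5 : (R 1 - 1 / n) / R 1 < Real.exp (-θ * x₀) := by
        rw [neg_mul, Real.exp_neg, ← inv_div]
        exact inv_strictAnti₀ (Real.exp_pos _) h4
      have h6 : θ * k = n * R 1 * (1 - Real.exp (-θ * x₀)) := by
        rw [hk, scale, if_neg h.ne', ← hθ]
        field_simp
      rw [div_lt_iff₀ hR1] at h5
      have h7 : (n : ℝ) * (1 / n) = 1 := by field_simp
      rw [h6]
      nlinarith
    -- The level `c` is chosen so that `scale μ σ c` is the midpoint of `k` and `1 / θ`.
    have hpos : 0 < (1 - θ * k) / 2 := by linarith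
    refine ⟨-Real.log ((1 - θ * k) / 2) / θ, ?_⟩
    have he : -θ * (-Real.log ((1 - θ * k) / 2) / θ) = Real.log ((1 - θ * k) / 2) := by
      field_simp
    rw [scale, if_neg h.ne', ← hθ, he, Real.exp_log hpos, lt_div_iff₀ hθ0]
    linarith

/-- The potential as a function of the natural scale. -/
noncomputable def scaledPotential (μ σ y : ℝ) : ℝ :=
  if μ = 0 then y ^ 2 / σ ^ 2 else -Real.log (1 - 2 * μ / σ ^ 2 * y) / (2 * μ / σ ^ 2 * μ)

/-- The derivative of `scaledPotential`. -/
noncomputable def scaledPotentialDeriv (μ σ y : ℝ) : ℝ :=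
  if μ = 0 then 2 * y / σ ^ 2 else 1 / (μ * (1 - 2 * μ / σ ^ 2 * y))

lemma scaledPotential_scale (μ : ℝ) (hσ : 0 < σ) (x : ℝ) :
    scaledPotential μ σ (scale μ σ x) = potential μ σ x := by
  by_cases h : μ = 0
  · simp [scaledPotential, scale, potential, h]
  · have hθ : 2 * μ / σ ^ 2 ≠ 0 := by positivity
    simp only [scaledPotential, scale, potential, h, if_false]
    rw [mul_div_cancel₀ _ hθ, sub_sub_cancel, Real.log_exp]
    field_simp

/-- Keeps the logarithm in `scaledPotential` away from its singularity: with `θ = 2 * μ / σ ^ 2`,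
one has `1 - θ * scale μ σ c = exp (-θ * c)`. -/
lemma one_sub_mul_pos_of_lt_scale (hμ : μ ≠ 0) (hσ : 0 < σ) {y c : ℝ} (hy : 0 ≤ y)
    (hyc : y < scale μ σ c) : 0 < 1 - 2 * μ / σ ^ 2 * y := by
  rcases lt_or_gt_of_ne hμ with h | h
  · have hθ : 2 * μ / σ ^ 2 < 0 := div_neg_of_neg_of_pos (by linarith) (by positivity)
    nlinarith
  · have hθ : 0 < 2 * μ / σ ^ 2 := by positivity
    rw [scale, if_neg hμ, lt_div_iff₀ hθ] at hyc
    have := Real.exp_pos (-(2 * μ / σ ^ 2) * c)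
    linarith

lemma continuousOn_scaledPotential (hσ : 0 < σ) {K c : ℝ} (hK : K < scale μ σ c) :
    ContinuousOn (scaledPotential μ σ) (Set.Icc 0 K) := by
  unfold scaledPotential
  split_ifs with h
  · fun_prop
  · refine ((ContinuousOn.log (by fun_prop) fun y hy => ?_).neg).div_const _
    exact (one_sub_mul_pos_of_lt_scale h hσ hy.1 (hy.2.trans_lt hK)).ne'

lemma continuousOn_scaledPotentialDeriv (hσ : 0 < σ) {K c : ℝ} (hK : K < scale μ σ c) :
    ContinuousOn (scaledPotentialDeriv μ σ) (Set.Icc 0 K) := by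
  unfold scaledPotentialDeriv
  split_ifs with h
  · fun_prop
  · refine continuousOn_const.div (by fun_prop) fun y hy => ?_
    exact mul_ne_zero h (one_sub_mul_pos_of_lt_scale h hσ hy.1 (hy.2.trans_lt hK)).ne'

/-- `scaledPotential` is convex. -/
lemma scaledPotential_tangent (hσ : 0 < σ) {K c : ℝ} (hK : K < scale μ σ c) :
    ∀ y ∈ Set.Icc 0 K, ∀ z ∈ Set.Icc 0 K,
      scaledPotential μ σ z + scaledPotentialDeriv μ σ z * (y - z) ≤ scaledPotential μ σ y := by
  intro y hy z hz
  by_cases h : μ = 0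
  · simp only [scaledPotential, scaledPotentialDeriv, h, if_true]
    rw [div_mul_eq_mul_div, ← add_div]
    refine div_le_div_of_nonneg_right ?_ (by positivity)
    nlinarith [sq_nonneg (y - z)]
  · have hA := one_sub_mul_pos_of_lt_scale h hσ hy.1 (hy.2.trans_lt hK)
    have hB := one_sub_mul_pos_of_lt_scale h hσ hz.1 (hz.2.trans_lt hK)
    simp only [scaledPotential, scaledPotentialDeriv, h, if_false]
    have hθ : 2 * μ / σ ^ 2 ≠ 0 := by positivity
    have hθμ : 0 < 2 * μ / σ ^ 2 * μ := by
      have : 2 * μ / σ ^ 2 * μ = 2 * μ ^ 2 / σ ^ 2 := by ring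
      rw [this]
      positivity
    set θ := 2 * μ / σ ^ 2
    -- `log t ≤ t - 1` at the ratio of the two arguments is the tangent inequality for `-log`;
    -- dividing by `θ * μ > 0` preserves it for either sign of `μ`.
    have h1 := Real.log_le_sub_one_of_pos (div_pos hA hB)
    rw [Real.log_div hA.ne' hB.ne'] at h1
    have h2 : 1 / (μ * (1 - θ * z)) * (y - z) =
        (1 - (1 - θ * y) / (1 - θ * z)) / (θ * μ) := by
      field_simp
      ring
    rw [h2, ← add_div]
    refine div_le_div_of_nonneg_right ?_ hθμ.le
    linarith

/-- The expected duration in equilibrium as a function of the reward scheme. -/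
theorem Play.IsEquilibriumPlay.duration_eq {S : Play.{u}} (hn : 2 ≤ n)
    (hR : IsNormalizedScheme n R) (hx₀ : 0 < x₀) (hσ : 0 < σ)
    (hμ : μ < criticalDrift n R x₀ σ) (hS : S.IsEquilibriumPlay n R x₀ μ σ) :
    S.duration = ENNReal.ofReal ((∫ q in (0 : ℝ)..1,
      scaledPotential μ σ (n * scale μ σ x₀ * quantileReward (n - 1) R q)) -
        potential μ σ x₀) := by
  obtain ⟨c, hc⟩ := exists_lt_scale hn hR hx₀ hσ hμ
  have hprob := S.isProbabilityMeasure_law hx₀ μ σ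
  obtain ⟨hna, hscale, hs⟩ := IsEquilibrium.structure hn hR hx₀ hσ hS
  have hs0 : 0 < scale μ σ x₀ := (scale_zero μ σ).symm.trans_lt (strictMono_scale μ hσ hx₀)
  have hmem {q : ℝ} (hq : q ∈ Set.Icc (0 : ℝ) 1) :
      n * scale μ σ x₀ * quantileReward (n - 1) R q ∈ Set.Icc 0 (n * scale μ σ x₀ * R 1) := by
    have h := hR.quantileReward_mem hn hq
    have h0 : 0 ≤ n * scale μ σ x₀ := by positivity
    exact ⟨mul_nonneg h0 h.1, mul_le_mul_of_nonneg_left h.2 h0⟩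
  rw [S.duration_eq hx₀ μ hσ (k := n * scale μ σ x₀ * R 1) (c := c) ?_ ?_ hc hs]
  · congr 2
    have hFc : Continuous fun x => (S.law x₀ μ σ).real (Set.Iic x) := continuous_real_Iic
    have h1 : ContinuousOn (fun q : ℝ => scaledPotential μ σ
        (n * scale μ σ x₀ * quantileReward (n - 1) R q)) (Set.Icc 0 1) :=
      (continuousOn_scaledPotential hσ hc).comp
        (continuous_const.mul (continuous_quantileReward _ _)).continuousOn fun q hq => hmem hq
    rw [intervalIntegral.integral_of_le zero_le_one, ← integral_Icc_eq_integral_Ioc,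
      ← map_real_Iic (F := S.law x₀ μ σ), integral_map hFc.measurable.aemeasurable]
    · refine integral_congr_ae ?_
      filter_upwards [hscale] with x hx
      rw [← hx, scaledPotential_scale μ hσ]
    · rw [map_real_Iic]
      exact h1.aestronglyMeasurable measurableSet_Icc
  · rw [ae_iff]
    simp
  · filter_upwards [hscale] with x hx
    rw [hx]
    exact (hmem ⟨measureReal_nonneg, measureReal_le_one⟩).2

theorem duration_le_of_lorenzLE {S : Play.{u}} {S' : Play.{v}} (hn : 2 ≤ n) (hx₀ : 0 < x₀)
    (hσ : 0 < σ) (hR : IsNormalizedScheme n R) (hR' : IsNormalizedScheme n R')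
    (hμ : μ < criticalDrift n R x₀ σ) (hμ' : μ < criticalDrift n R' x₀ σ)
    (hL : LorenzLE n R' R) (hS : S.IsEquilibriumPlay n R x₀ μ σ)
    (hS' : S'.IsEquilibriumPlay n R' x₀ μ σ) : S'.duration ≤ S.duration := by
  rw [hS.duration_eq hn hR hx₀ hσ hμ, hS'.duration_eq hn hR' hx₀ hσ hμ']
  refine ENNReal.ofReal_le_ofReal (sub_le_sub_right ?_ _)
  obtain ⟨c, hc⟩ := exists_lt_scale hn hR hx₀ hσ hμ
  have hs0 : 0 < scale μ σ x₀ := (scale_zero μ σ).symm.trans_lt (strictMono_scale μ hσ hx₀)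
  have h0 : 0 ≤ n * scale μ σ x₀ := by positivity
  have hn1 : n - 1 + 1 = n := by omega
  -- The Lorenz order at `k = 1` keeps the scaled levels of `R'` inside the interval `[0, K]` that
  -- belongs to `R`.
  have hfirst : R' 1 ≤ R 1 := by
    simpa using hL.2 1 (Finset.mem_Icc.2 ⟨le_rfl, by omega⟩)
  rw [← hn1] at hL
  refine integral_comp_quantileReward_le hL h0
    (continuousOn_scaledPotential hσ hc) (continuousOn_scaledPotentialDeriv hσ hc)
    (scaledPotential_tangent hσ hc) (fun q hq => ?_) (fun q hq => ?_)
    (monotoneOn_quantileReward hn hR')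
  · have h := hR.quantileReward_mem hn hq
    exact ⟨mul_nonneg h0 h.1, mul_le_mul_of_nonneg_left h.2 h0⟩
  · have h := hR'.quantileReward_mem hn hq
    exact ⟨mul_nonneg h0 h.1, mul_le_mul_of_nonneg_left (h.2.trans hfirst) h0⟩

end Duration

/-! ### The extremal schemes -/

section Extremal

variable {n : ℕ} {R : ℕ → ℝ}

lemma sum_winnerTakesAll {k : ℕ} (hk : 1 ≤ k) :
    ∑ i ∈ Finset.Icc 1 k, winnerTakesAll i = 1 := by
  simp [winnerTakesAll, hk]

lemma isNormalizedScheme_winnerTakesAll (hn : 2 ≤ n) : IsNormalizedScheme n winnerTakesAll := by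
  refine ⟨fun i hi j hj hij => ?_, ?_, sum_winnerTakesAll (by omega)⟩
  · have := hi.1
    unfold winnerTakesAll
    split_ifs
    · exact le_rfl
    · omega
    · exact zero_le_one
    · exact le_rfl
  · simp only [winnerTakesAll]
    rw [if_neg (by omega)]

lemma lorenzLE_winnerTakesAll (hn : 2 ≤ n) (hR : IsNormalizedScheme n R) :
    LorenzLE n R winnerTakesAll := by
  refine ⟨?_, fun k hk => ?_⟩
  · rw [hR.total_eq_one, sum_winnerTakesAll (by omega)]
  · obtain ⟨hk1, hkn⟩ := Finset.mem_Icc.1 hk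
    rw [sum_winnerTakesAll hk1, ← hR.total_eq_one]
    refine Finset.sum_le_sum_of_subset_of_nonneg (Finset.Icc_subset_Icc_right hkn)
      fun i hi _ => hR.nonneg (Finset.mem_Icc.1 hi)

lemma sum_uniformScheme {k : ℕ} (hk : k < n) :
    ∑ i ∈ Finset.Icc 1 k, uniformScheme n i = k / ((n : ℝ) - 1) := by
  have : ∀ i ∈ Finset.Icc 1 k, uniformScheme n i = 1 / ((n : ℝ) - 1) := fun i hi => by
    rw [uniformScheme, if_pos ((Finset.mem_Icc.1 hi).2.trans_lt hk)]
  rw [Finset.sum_congr rfl this]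
  simp [div_eq_mul_inv]

lemma isNormalizedScheme_uniformScheme (hn : 2 ≤ n) :
    IsNormalizedScheme n (uniformScheme n) := by
  have hn' : (2 : ℝ) ≤ n := by exact_mod_cast hn
  have hpos : 0 < 1 / ((n : ℝ) - 1) := by
    have : (0 : ℝ) < n - 1 := by linarith
    positivity
  have hlast : uniformScheme n n = 0 := by simp [uniformScheme]
  refine ⟨fun i hi j hj hij => ?_, hlast, ?_⟩
  · unfold uniformScheme
    split_ifs
    · exact le_rfl
    · omega
    · exact hpos.le
    · exact le_rfl
  · obtain ⟨N, rfl⟩ : ∃ N, n = N + 1 := ⟨n - 1, by omega⟩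
    rw [Finset.sum_Icc_succ_top (by omega), hlast, add_zero, sum_uniformScheme (by omega)]
    push_cast at hn' ⊢
    rw [add_sub_cancel_right]
    exact div_self (by linarith)

lemma uniformScheme_lorenzLE (hn : 2 ≤ n) (hR : IsNormalizedScheme n R) :
    LorenzLE n (uniformScheme n) R := by
  have htot := (isNormalizedScheme_uniformScheme hn).total_eq_one.trans hR.total_eq_one.symm
  refine ⟨htot, fun k hk => ?_⟩
  obtain ⟨hk1, hkn⟩ := Finset.mem_Icc.1 hk
  rcases hkn.eq_or_lt with rfl | hlt
  · exact htot.le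
  · rw [sum_uniformScheme hlt]
    exact hR.le_sum hk1 hlt

end Extremal

end RankGame

theorem corollary3 (n : ℕ) (hn : 2 ≤ n) (x₀ μ σ : ℝ) (hx₀ : 0 < x₀) (hσ : 0 < σ) :
    -- the expected duration in equilibrium is finite
    (∀ R : ℕ → ℝ, RankGame.IsNormalizedScheme n R →
      μ < RankGame.criticalDrift n R x₀ σ →
      ∀ S : RankGame.Play.{u}, S.IsEquilibriumPlay n R x₀ μ σ → S.duration < ∞) ∧
    -- it is increasing with respect to the Lorenz order of the reward scheme
    (∀ R R' : ℕ → ℝ, RankGame.IsNormalizedScheme n R → RankGame.IsNormalizedScheme n R' →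
      μ < RankGame.criticalDrift n R x₀ σ → μ < RankGame.criticalDrift n R' x₀ σ →
      RankGame.LorenzLE n R' R →
      ∀ (S : RankGame.Play.{u}) (S' : RankGame.Play.{v}),
        S.IsEquilibriumPlay n R x₀ μ σ → S'.IsEquilibriumPlay n R' x₀ μ σ →
        S'.duration ≤ S.duration) ∧
    -- winner-takes-all maximizes it
    (RankGame.IsNormalizedScheme n RankGame.winnerTakesAll ∧
      (μ < RankGame.criticalDrift n RankGame.winnerTakesAll x₀ σ →
        ∀ R : ℕ → ℝ, RankGame.IsNormalizedScheme n R →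
        ∀ (S : RankGame.Play.{u}) (S' : RankGame.Play.{v}),
          S.IsEquilibriumPlay n RankGame.winnerTakesAll x₀ μ σ →
          S'.IsEquilibriumPlay n R x₀ μ σ →
          S'.duration ≤ S.duration)) ∧
    -- the uniform scheme minimizes it
    (RankGame.IsNormalizedScheme n (RankGame.uniformScheme n) ∧
      ∀ R : ℕ → ℝ, RankGame.IsNormalizedScheme n R →
        μ < RankGame.criticalDrift n R x₀ σ →
        ∀ (S : RankGame.Play.{u}) (S' : RankGame.Play.{v}),
          S.IsEquilibriumPlay n R x₀ μ σ →
          S'.IsEquilibriumPlay n (RankGame.uniformScheme n) x₀ μ σ →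
          S'.duration ≤ S.duration) := by
  have hW := RankGame.isNormalizedScheme_winnerTakesAll hn
  have hU := RankGame.isNormalizedScheme_uniformScheme hn
  have hfirst {R R' : ℕ → ℝ} (h : RankGame.LorenzLE n R' R) : R' 1 ≤ R 1 := by
    simpa using h.2 1 (Finset.mem_Icc.2 ⟨le_rfl, by omega⟩)
  refine ⟨fun R hR hμ S hS => ?_, fun R R' hR hR' hμ hμ' hL S S' hS hS' =>
    RankGame.duration_le_of_lorenzLE hn hx₀ hσ hR hR' hμ hμ' hL hS hS',
    ⟨hW, fun hμ R hR S S' hS hS' => ?_⟩, ⟨hU, fun R hR hμ S S' hS hS' => ?_⟩⟩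
  · rw [hS.duration_eq hn hR hx₀ hσ hμ]
    exact ENNReal.ofReal_lt_top
  -- Every scheme is below winner-takes-all, and its smaller first prize gives it a critical drift
  -- at least as large, so subcriticality is inherited.
  · have hL := RankGame.lorenzLE_winnerTakesAll hn hR
    exact RankGame.duration_le_of_lorenzLE hn hx₀ hσ hW hR hμ
      (hμ.trans_le (RankGame.criticalDrift_anti hn hW hR hx₀ (hfirst hL))) hL hS hS'
  · have hL := RankGame.uniformScheme_lorenzLE hn hR
    exact RankGame.duration_le_of_lorenzLE hn hx₀ hσ hR hU hμ
      (hμ.trans_le (RankGame.criticalDrift_anti hn hR hU hx₀ (hfirst hL))) hL hS hS'
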